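/- Let $\mathbb M=(M,<,\dots)$ be an o-minimal structure, i.e. a first-order structure expanding a nonempty dense linear order $(M,<)$ without endpoints such that every definable subset of $M$ is a finite union of points and open intervals with endpoints in $M\cup\{-\infty,+\infty\}$. Here and below, "definable" means definable with parameters from $M$, a map between definable sets is definable if its graph is, $M$ carries the order topology and $M^n$ the product topology. Suppose that $\mathbb M$ has definable choice functions: for all $m,n\ge 0$ and every definable $S\subseteq M^m\times M^n$ with projection $\pi(S)\subseteq M^m$ there is a definable map $f\colon \pi(S)\to M^n$ with $(x,f(x))\in S$ for all $x\in\pi(S)$. Let $n\ge 0$ and let $U\subseteq M^n$ be an open definable set. Then there are finitely many open definable sets $V_1,\dots,V_k\subseteq M^n$ with $U=V_1\cup\dots\cup V_k$ such that for each $j$ there are a permutation $\sigma$ of $\{1,\dots,n\}$ and an open cell $C\subseteq M^n$ such that $(x_1,\dots,x_n)\mapsto(x_{\sigma(1)},\dots,x_{\sigma(n)})$ restricts to a definable homeomorphism from $V_j$ onto $C$. Here open cells are defined inductively: the one-point space $M^0$ is an open cell in $M^0$; an open cell in $M^{n+1}$ is a set of the form $\{(x,y)\in X\times M: f(x)<y<g(x)\}$,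 where $X$ is an open cell in $M^n$, each of $f$ and $g$ is either a continuous definable function $X\to M$ or one of the constant functions $-\infty,+\infty$, and $f(x)<g(x)$ for all $x\in X$. -/

import Mathlib

namespace OMin

open Set FirstOrder

section General

variable (L : Language) {M : Type*} [L.Structure M]

/-- A set is definable, with arbitrary parameters from `M`. -/
def Def {α : Type*} (X : Set (α → M)) : Prop :=
  (univ : Set M).Definable L X

/-- The map `f`, restricted to `X ⊆ M ^ α`, is a definable map `X → M ^ β`: its graph is a
definable set. Values of `f` outside `X` are irrelevant. -/
def DefMap {α β : Type*} (X : Set (α → M)) (f : (α → M) → (β → M)) : Prop :=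
  Def L {z : α ⊕ β → M | z ∘ Sum.inl ∈ X ∧ z ∘ Sum.inr = f (z ∘ Sum.inl)}

/-- The function `f`, restricted to `X ⊆ M ^ α`, is a definable function `X → M`. -/
def DefFun {α : Type*} (X : Set (α → M)) (f : (α → M) → M) : Prop :=
  DefMap L X (fun x (_ : Unit) => f x)

variable (M) in
/-- The structure has definable choice functions: for every definable `S ⊆ M ^ m × M ^ n`
with projection `π S ⊆ M ^ m`, there is a definable map `f : π S → M ^ n` whose graph is
contained in `S`. -/
def HasDefinableChoice : Prop :=
  ∀ (m n : ℕ) (S : Set (Fin m ⊕ Fin n → M)), Def L S →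
    ∃ f : (Fin m → M) → (Fin n → M),
      DefMap L ((fun z : Fin m ⊕ Fin n → M => z ∘ Sum.inl) '' S) f ∧
      ∀ x ∈ (fun z : Fin m ⊕ Fin n → M => z ∘ Sum.inl) '' S, Sum.elim x (f x) ∈ S

/-- `f` restricts to a definable homeomorphism from `X` onto `Y`. -/
def IsDefHomeo [TopologicalSpace M] {α β : Type*} (f : (α → M) → (β → M))
    (X : Set (α → M)) (Y : Set (β → M)) : Prop :=
  DefMap L X f ∧ ∃ e : X ≃ₜ Y, ∀ x : X, (e x : β → M) = f x

end General

/-- Open intervals with endpoints in `M ∪ {-∞, +∞}`. -/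
def IsInterval {M : Type*} [LinearOrder M] (I : Set M) : Prop :=
  (∃ a b : M, a < b ∧ I = Ioo a b) ∨ (∃ a : M, I = Iio a) ∨ (∃ a : M, I = Ioi a) ∨ I = univ

/-- O-minimality: every definable subset of `M` is a finite union of points and intervals. -/
def IsOMinimal (L : Language) (M : Type*) [LinearOrder M] [L.Structure M] : Prop :=
  ∀ X : Set M, (univ : Set M).Definable₁ L X →
    ∃ 𝒮 : Set (Set M), 𝒮.Finite ∧ (∀ I ∈ 𝒮, (∃ a : M, I = {a}) ∨ IsInterval I) ∧ X = ⋃₀ 𝒮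

section Cells

variable (L : Language) {M : Type*} [LinearOrder M] [TopologicalSpace M] [L.Structure M]

/-- Restricted to `X`, the function `F` is either a continuous definable function `X → M`, or
the constant `-∞`, or the constant `+∞`. -/
def IsBound {n : ℕ} (X : Set (Fin n → M)) (F : (Fin n → M) → WithBot (WithTop M)) : Prop :=
  (∃ f : (Fin n → M) → M, ContinuousOn f X ∧ DefFun L X f ∧
    ∀ x ∈ X, F x = ((f x : WithTop M) : WithBot (WithTop M))) ∨
  (∀ x ∈ X, F x = ⊥) ∨ (∀ x ∈ X, F x = ⊤)

/-- `(i₁, …, iₙ)`-cells in `M ^ n`, where `false` stands for `0` and `true` for `1`.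
The one-point space `M ^ 0` is a `()`-cell. For an `(i₁, …, iₙ)`-cell `X`, the graph of a
continuous definable function on `X` is an `(i₁, …, iₙ, 0)`-cell, and the set of points lying
strictly between two bounds `F < G` on `X` is an `(i₁, …, iₙ, 1)`-cell.
Thus `(0)`-cells are points and `(1)`-cells are intervals. -/
def IsCell : (n : ℕ) → (Fin n → Bool) → Set (Fin n → M) → Prop
  | 0, _, C => C = univ
  | n + 1, i, C => ∃ X : Set (Fin n → M), IsCell n (i ∘ Fin.castSucc) X ∧
      ((i (Fin.last n) = false ∧ ∃ f : (Fin n → M) → M, ContinuousOn f X ∧ DefFun L X f ∧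
          C = {x : Fin (n + 1) → M | x ∘ Fin.castSucc ∈ X ∧ x (Fin.last n) = f (x ∘ Fin.castSucc)}) ∨
        (i (Fin.last n) = true ∧ ∃ F G : (Fin n → M) → WithBot (WithTop M),
          IsBound L X F ∧ IsBound L X G ∧ (∀ x ∈ X, F x < G x) ∧
          C = {x : Fin (n + 1) → M | x ∘ Fin.castSucc ∈ X ∧
            F (x ∘ Fin.castSucc) < ((x (Fin.last n) : WithTop M) : WithBot (WithTop M)) ∧
            ((x (Fin.last n) : WithTop M) : WithBot (WithTop M)) < G (x ∘ Fin.castSucc)}))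

/-- Open cells in `M ^ n`: the `(1, …, 1)`-cells. -/
def IsOpenCell {n : ℕ} (C : Set (Fin n → M)) : Prop :=
  IsCell L n (fun _ => true) C

end Cells

end OMin

/-!
Call a set a permuted open cell if it becomes an open cell after a permutation of the coordinates;
such a set is open and definable, and the permutation is a definable homeomorphism. So an open
definable set `U ⊆ M ^ n` has to be written as a finite union of permuted open cells. Now `U` is a
finite union of open cells, which can be kept, and of *thin* sets, sets on which forgetting some
coordinate is injective. A thin set has to be covered by permuted open cells inside `U`, by
induction on the dimension: it is the image of a definable `D ⊆ M ^ k`, `k < n`, under a definable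
map `ψ` that inserts `n - k` coordinates. By definable choice, every point `ψ x` has a box in `U`
around it whose corners are definable functions of `x ∈ D`. Again `D` is a finite union of open
cells and thin sets, and all box corners can be made continuous on the open cells. Over such a
cell, the points whose inserted coordinates lie in the box around `ψ x` form a tube in `U` around
the image of the cell. As the coordinates of the cell can be put first and the sides of the box
depend only on them, the tube is a permuted open cell (`isOpenCell_tube`, `exists_cover_image`).

The argument uses two facts. The first is generic tameness (`tame_fin`): on a dense open set,
definable predicates are locally constant and definable functions are continuous. It follows by
induction on the dimension from the monotonicity theorem in one variable
(`exists_subinterval_continuous_monotone`), because a function that is continuous in each variable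
and monotone in the last one is continuous.

The second is that definable sets are finite unions of open cells and thin sets (`decomposable`),
proved together with uniform finiteness (`UniformlyFinite`) by induction on the dimension. Given a
definable subset of `M ^ (k + 1)`, uniform finiteness provides finitely many definable functions on
`M ^ k` that contain all boundary points of its fibres, and the set is cut along their graphs
(`decomposable_succ`). Conversely, a definable family of finite sets is generically locally trivial
(`eventually_generic_normal`), so the size of its members is locally constant
(`eventually_ncard_eq`). Open cells being definably connected (`IsOpenCell.iff_of_locConst`), the
size is constant on the open cells of a decomposition of the locus of local triviality, while thin
sets are parametrized by a lower-dimensional space (`uniformlyFinite_of_decomposable`).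

Definability is handled through predicates `DP` and maps `DF` on finite powers of `M` and products
of these, with closure rules that `fun_prop` applies.
-/

namespace OMin

open Set Filter Topology FirstOrder

set_option linter.unusedSectionVars false

/-! ### Definable predicates and maps -/

/-- A presentation of the topological space `X` as a finite power of `M`. It gives a meaning to
definability for subsets of `X`, and for maps between such spaces. -/
class DefSpace (M : Type*) [TopologicalSpace M] (X : Type*) [TopologicalSpace X] where
  /-- The index set of the coordinates. -/
  idx : Type
  [finite_idx : Finite idx]
  /-- The homeomorphism with a power of `M`. -/
  coord : X ≃ₜ (idx → M)

attribute [instance] DefSpace.finite_idx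

section Definability

variable {L : Language} {M : Type*} [TopologicalSpace M] [L.Structure M]
variable {X Y Z P : Type*} [TopologicalSpace X] [TopologicalSpace Y] [TopologicalSpace Z]
  [TopologicalSpace P]

open DefSpace

instance : DefSpace M M where
  idx := Unit
  coord := (Homeomorph.funUnique Unit M).symm

instance {ι : Type} [Finite ι] : DefSpace M (ι → M) where
  idx := ι
  coord := Homeomorph.refl _

instance [DefSpace M X] [DefSpace M Y] : DefSpace M (X × Y) where
  idx := idx M X ⊕ idx M Y
  coord := ((coord (M := M) (X := X)).prodCongr coord).trans
    Homeomorph.sumArrowHomeomorphProdArrow.symm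

variable [DefSpace M X] [DefSpace M Y] [DefSpace M Z] [DefSpace M P]

variable (L M) in
/-- A definable predicate on `X`, with parameters. -/
@[fun_prop]
def DP (p : X → Prop) : Prop :=
  Def L {v : idx M X → M | p (coord.symm v)}

variable (L M) in
/-- A definable map `X → Y`: one whose graph is definable. -/
@[fun_prop]
def DF (f : X → Y) : Prop :=
  DP L M (fun q : X × Y => f q.1 = q.2)

/-! ### Closure properties of definable predicates and maps -/

/-- Definable predicates can be pulled back along maps that select coordinates. -/
lemma DP.subst {p : Y → Prop} (hp : DP L M p) (φ : X → Y) (s : idx M Y → idx M X)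
    (h : ∀ x j, (coord (φ x) : idx M Y → M) j = (coord x : idx M X → M) (s j)) :
    DP L M (fun x => p (φ x)) := by
  have := hp.preimage_comp s
  unfold DP Def
  convert! this using 1
  ext v
  simp only [mem_preimage, mem_ofPred_eq]
  have : φ (coord.symm v) = coord.symm (v ∘ s) := by
    rw [Homeomorph.eq_symm_apply]
    ext j
    simp [h]
  rw [this]

lemma coord_prod (x : X) (y : Y) :
    (coord (x, y) : idx M (X × Y) → M) = Sum.elim (coord x) (coord y) := by
  ext j
  cases j <;> rfl

@[fun_prop]
lemma DP.and {p q : X → Prop} (hp : DP L M p) (hq : DP L M q) : DP L M (fun x => p x ∧ q x) :=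
  Definable.inter hp hq

@[fun_prop]
lemma DP.or {p q : X → Prop} (hp : DP L M p) (hq : DP L M q) : DP L M (fun x => p x ∨ q x) :=
  Definable.union hp hq

@[fun_prop]
lemma DP.not {p : X → Prop} (hp : DP L M p) : DP L M (fun x => ¬ p x) :=
  Definable.compl hp

lemma DP.imp {p q : X → Prop} (hp : DP L M p) (hq : DP L M q) : DP L M (fun x => p x → q x) := by
  simpa only [imp_iff_not_or] using hp.not.or hq

@[fun_prop]
lemma DP.const (a : Prop) : DP L M (fun _ : X => a) := by
  by_cases h : a
  · simp only [DP, h, Def, ofPred_true, definable_univ]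
  · simp only [DP, h, Def, ofPred_false, definable_empty]

@[fun_prop]
lemma DP.ex {p : X → Y → Prop} (hp : DP L M (fun q : X × Y => p q.1 q.2)) :
    DP L M (fun x => ∃ y, p x y) := by
  have := Definable.exists_of_finite (α := idx M X) (β := idx M Y) hp
  unfold DP Def
  convert! this using 1
  ext v
  change (∃ y, p (coord.symm v) y) ↔ _
  rw [(coord (M := M) (X := Y)).symm.surjective.exists]
  refine exists_congr fun u => ?_
  let w : idx M (X × Y) → M := Sum.elim v u
  have hw : coord.symm w = (coord.symm v, coord.symm u) := by
    rw [Homeomorph.symm_apply_eq, coord_prod]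
    simp [w]
  change _ ↔ p (coord.symm w).1 (coord.symm w).2
  rw [hw]

lemma DP.all {p : X → Y → Prop} (hp : DP L M (fun q : X × Y => p q.1 q.2)) :
    DP L M (fun x => ∀ y, p x y) := by
  have := DP.ex (p := fun x y => ¬ p x y) hp.not
  simpa only [not_exists, not_not] using this.not

lemma DP.all_fin {ι : Type*} [Finite ι] {p : ι → X → Prop} (hp : ∀ i, DP L M (p i)) :
    DP L M (fun x => ∀ i, p i x) := by
  have := definable_iInter_of_finite hp
  unfold DP Def
  convert! this using 1
  ext v
  simp

lemma DP.ex_fin {ι : Type*} [Finite ι] {p : ι → X → Prop} (hp : ∀ i, DP L M (p i)) :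
    DP L M (fun x => ∃ i, p i x) := by
  simpa only [not_forall, not_not] using (DP.all_fin fun i => (hp i).not).not

lemma DP.coord_eq (i j : idx M X) :
    DP L M (fun x : X => (coord x : idx M X → M) i = (coord x : idx M X → M) j) := by
  refine ⟨(Language.Term.var i).equal (Language.Term.var j), ?_⟩
  ext v
  simp

lemma coord_fst (q : X × Y) (i : idx M X) :
    (coord q : idx M (X × Y) → M) (Sum.inl i) = (coord q.1 : idx M X → M) i := rfl

lemma coord_snd (q : X × Y) (i : idx M Y) :
    (coord q : idx M (X × Y) → M) (Sum.inr i) = (coord q.2 : idx M Y → M) i := rfl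

/-- A map whose coordinates are among the coordinates of its argument is definable. -/
lemma DF.of_coord (φ : X → Y) (s : idx M Y → idx M X)
    (h : ∀ x j, (coord (φ x) : idx M Y → M) j = (coord x : idx M X → M) (s j)) : DF L M φ := by
  have : ∀ q : X × Y, φ q.1 = q.2 ↔
      ∀ j, (coord q : idx M (X × Y) → M) (Sum.inr j) =
        (coord q : idx M (X × Y) → M) (Sum.inl (s j)) := by
    intro q
    simp only [coord_fst, coord_snd, ← h]
    rw [← (coord (M := M) (X := Y)).injective.eq_iff, funext_iff]
    exact forall_congr' fun j => eq_comm
  unfold DF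
  simp only [this]
  exact DP.all_fin fun j => DP.coord_eq _ _

@[fun_prop]
lemma DF.id : DF L M (fun x : X => x) := DF.of_coord _ (fun j => j) fun _ _ => rfl

@[fun_prop]
lemma DF.fst : DF L M (fun q : X × Y => q.1) := DF.of_coord _ Sum.inl fun _ _ => rfl

@[fun_prop]
lemma DF.snd : DF L M (fun q : X × Y => q.2) := DF.of_coord _ Sum.inr fun _ _ => rfl

@[fun_prop]
lemma DF.apply {ι : Type} [Finite ι] (i : ι) : DF L M (fun x : ι → M => x i) :=
  DF.of_coord _ (fun _ => i) fun _ _ => rfl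

@[fun_prop]
lemma DF.const (c : Y) : DF L M (fun _ : X => c) := by
  have : ∀ q : X × Y, c = q.2 ↔
      ∀ j, (coord q : idx M (X × Y) → M) (Sum.inr j) = (coord c : idx M Y → M) j := by
    intro q
    simp only [coord_snd]
    rw [← (coord (M := M) (X := Y)).injective.eq_iff, funext_iff]
    exact forall_congr' fun j => eq_comm
  unfold DF
  simp only [this]
  refine DP.all_fin fun j => ?_
  have h := (Definable.singleton_of_mem L (mem_univ ((coord c : idx M Y → M) j))).preimage_comp
    (fun _ : Fin 1 => (Sum.inr j : idx M (X × Y)))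
  unfold DP Def
  convert! h using 1
  ext v
  simp only [Homeomorph.apply_symm_apply]
  rfl

/-- The composition of a definable predicate with a definable map is definable. -/
@[fun_prop]
lemma DP.comp {p : Y → Prop} {f : X → Y} (hp : DP L M p) (hf : DF L M f) :
    DP L M (fun x => p (f x)) := by
  have h2 : DP L M (fun q : X × Y => p q.2) := hp.subst _ Sum.inr fun _ _ => rfl
  have := DP.ex (p := fun x y => f x = y ∧ p y) (DP.and hf h2)
  simpa using this

@[fun_prop]
lemma DF.comp {f : Y → Z} {g : X → Y} (hf : DF L M f) (hg : DF L M g) :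
    DF L M (fun x => f (g x)) := by
  have h1 : DP L M (fun q : (X × Z) × Y => g q.1.1 = q.2) :=
    DP.subst hg (fun q : (X × Z) × Y => (q.1.1, q.2)) (Sum.elim (Sum.inl ∘ Sum.inl) Sum.inr) (by
      rintro x (j | j) <;> rfl)
  have h2 : DP L M (fun q : (X × Z) × Y => f q.2 = q.1.2) :=
    DP.subst hf (fun q : (X × Z) × Y => (q.2, q.1.2)) (Sum.elim Sum.inr (Sum.inl ∘ Sum.inr)) (by
      rintro x (j | j) <;> rfl)
  have := DP.ex (p := fun (x : X × Z) y => g x.1 = y ∧ f y = x.2) (DP.and h1 h2)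
  simpa [DF] using this

@[fun_prop]
lemma DF.prodMk {f : X → Y} {g : X → Z} (hf : DF L M f) (hg : DF L M g) :
    DF L M (fun x => (f x, g x)) := by
  have h1 : DP L M (fun q : X × (Y × Z) => f q.1 = q.2.1) :=
    DP.subst hf (fun q : X × (Y × Z) => (q.1, q.2.1)) (Sum.elim Sum.inl (Sum.inr ∘ Sum.inl)) (by
      rintro x (j | j) <;> rfl)
  have h2 : DP L M (fun q : X × (Y × Z) => g q.1 = q.2.2) :=
    DP.subst hg (fun q : X × (Y × Z) => (q.1, q.2.2)) (Sum.elim Sum.inl (Sum.inr ∘ Sum.inr)) (by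
      rintro x (j | j) <;> rfl)
  simpa only [DF, Prod.ext_iff] using h1.and h2

@[fun_prop]
lemma DF.pi {ι : Type} [Finite ι] {f : X → ι → M} (hf : ∀ i, DF L M (fun x => f x i)) :
    DF L M f := by
  have h : ∀ i, DP L M (fun q : X × (ι → M) => f q.1 i = q.2 i) := fun i =>
    DP.subst (hf i) (fun q : X × (ι → M) => (q.1, q.2 i))
      (Sum.elim Sum.inl (fun _ => Sum.inr i)) (by
      rintro x (j | j) <;> rfl)
  simpa only [DF, funext_iff] using DP.all_fin h

@[fun_prop]
lemma DP.eq {f g : X → Y} (hf : DF L M f) (hg : DF L M g) : DP L M (fun x => f x = g x) :=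
  DP.comp (f := fun x => (f x, g x)) (p := fun q : Y × Y => q.1 = q.2) DF.id (by fun_prop)

/-! ### Comparison with definable sets and maps in Cartesian powers -/

lemma definable₁_of_dp {p : M → Prop} (hp : DP L M p) : (univ : Set M).Definable₁ L {x | p x} :=
  DP.comp hp (DF.apply (0 : Fin 1))

lemma defMap_of_df {ι κ : Type} [Finite ι] [Finite κ] {S : Set (ι → M)}
    {f : (ι → M) → (κ → M)} (hS : Def L S) (hf : DF L M f) : DefMap L S f := by
  have hS' : DP L M (fun x => x ∈ S) := hS
  have : DP L M (fun q : (ι → M) × (κ → M) => q.1 ∈ S ∧ q.2 = f q.1) := by fun_prop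
  exact this

lemma defFun_of_df {ι : Type} [Finite ι] {S : Set (ι → M)} {f : (ι → M) → M}
    (hS : Def L S) (hf : DF L M f) : DefFun L S f :=
  defMap_of_df hS (by fun_prop)

/-- A map that is definable on a definable set agrees there with a definable map. -/
lemma exists_df_of_defMap [Nonempty M] {ι κ : Type} [Finite ι] [Finite κ] {S : Set (ι → M)}
    {f : (ι → M) → (κ → M)} (hf : DefMap L S f) :
    ∃ g : (ι → M) → (κ → M), DF L M g ∧ ∀ x ∈ S, g x = f x := by
  classical
  have h : DP L M (fun q : (ι → M) × (κ → M) => q.1 ∈ S ∧ q.2 = f q.1) := hf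
  let c : M := Classical.arbitrary M
  have h' : DP L M (fun x => x ∈ S) := by
    have := DP.ex (p := fun x y => x ∈ S ∧ y = f x) h
    simpa using this
  refine ⟨fun x => if x ∈ S then f x else fun _ => c, ?_, fun x hx => if_pos hx⟩
  have : ∀ q : (ι → M) × (κ → M), (if q.1 ∈ S then f q.1 else fun _ => c) = q.2 ↔
      (q.1 ∈ S ∧ q.2 = f q.1) ∨ (¬ q.1 ∈ S ∧ (fun _ => c) = q.2) := by
    intro q
    by_cases h : q.1 ∈ S <;> simp [h, eq_comm]
  unfold DF
  simp only [this]
  fun_prop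

lemma df_coord : DF L M (coord : X → idx M X → M) :=
  DF.of_coord _ (fun j => j) fun _ _ => rfl

lemma df_reindex {ι κ : Type} [Finite ι] [Finite κ] (s : κ → ι) :
    DF L M (fun x : ι → M => x ∘ s) :=
  DF.of_coord _ s fun _ _ => rfl

end Definability

section OMin

/-- The standing assumptions: the structure is o-minimal and has definable choice functions, and
the order is definable. -/
class OM (L : Language) (M : Type*) [LinearOrder M] [TopologicalSpace M] [L.Structure M] :
    Prop where
  omin : IsOMinimal L M
  lt : DP L M (fun q : M × M => q.1 < q.2)
  choice : HasDefinableChoice L M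

variable {L : Language} {M : Type*} [LinearOrder M] [TopologicalSpace M] [L.Structure M] [OM L M]
variable {X Y Z P : Type*} [TopologicalSpace X] [TopologicalSpace Y] [TopologicalSpace Z]
  [TopologicalSpace P] [DefSpace M X] [DefSpace M Y] [DefSpace M Z] [DefSpace M P]

@[fun_prop]
lemma DP.lt {f g : X → M} (hf : DF L M f) (hg : DF L M g) : DP L M (fun x => f x < g x) :=
  DP.comp (f := fun x => (f x, g x)) OM.lt (by fun_prop)

@[fun_prop]
lemma DP.le {f g : X → M} (hf : DF L M f) (hg : DF L M g) : DP L M (fun x => f x ≤ g x) := by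
  simp only [← not_lt]
  fun_prop

/-- Definable choice, for a definable relation between presented spaces. -/
lemma exists_df_choice [Nonempty M] {p : X → Y → Prop} (hp : DP L M (fun q : X × Y => p q.1 q.2)) :
    ∃ f : X → Y, DF L M f ∧ ∀ x, (∃ y, p x y) → p x (f x) := by
  obtain ⟨m, ⟨a⟩⟩ := Finite.exists_equiv_fin (DefSpace.idx M X)
  obtain ⟨n, ⟨b⟩⟩ := Finite.exists_equiv_fin (DefSpace.idx M Y)
  let S : Set (Fin m ⊕ Fin n → M) :=
    {z | p (DefSpace.coord.symm ((z ∘ Sum.inl) ∘ a)) (DefSpace.coord.symm ((z ∘ Sum.inr) ∘ b))}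
  have hS : Def L S := by
    have h1 : DF L M (fun z : Fin m ⊕ Fin n → M =>
      (DefSpace.coord.symm ((z ∘ Sum.inl) ∘ a) : X)) := DF.of_coord _ (Sum.inl ∘ a) (by
        intro x j; simp; rfl)
    have h2 : DF L M (fun z : Fin m ⊕ Fin n → M =>
      (DefSpace.coord.symm ((z ∘ Sum.inr) ∘ b) : Y)) := DF.of_coord _ (Sum.inr ∘ b) (by
        intro x j; simp; rfl)
    exact DP.comp (f := fun z : Fin m ⊕ Fin n → M =>
      ((DefSpace.coord.symm ((z ∘ Sum.inl) ∘ a) : X),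
        (DefSpace.coord.symm ((z ∘ Sum.inr) ∘ b) : Y))) hp (by fun_prop)
  obtain ⟨f, hf, hfS⟩ := OM.choice m n S hS
  obtain ⟨g, hg, hgf⟩ := exists_df_of_defMap hf
  refine ⟨fun x => DefSpace.coord.symm (g ((DefSpace.coord x : DefSpace.idx M X → M) ∘ a.symm) ∘ b),
    ?_, ?_⟩
  · have h1 : DF L M (fun x : X => (DefSpace.coord x : DefSpace.idx M X → M) ∘ a.symm) :=
      DF.of_coord _ a.symm fun _ _ => rfl
    have h2 : DF L M (fun z : Fin n → M => (DefSpace.coord.symm (z ∘ b) : Y)) :=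
      DF.of_coord _ b (by intro x j; simp; rfl)
    exact h2.comp (hg.comp h1)
  · rintro x ⟨y, hy⟩
    have hx : (DefSpace.coord x : DefSpace.idx M X → M) ∘ a.symm ∈
        (fun z : Fin m ⊕ Fin n → M => z ∘ Sum.inl) '' S := by
      refine ⟨Sum.elim ((DefSpace.coord x : DefSpace.idx M X → M) ∘ a.symm)
        ((DefSpace.coord y : DefSpace.idx M Y → M) ∘ b.symm), ?_, ?_⟩
      · have h1 : (Sum.elim ((DefSpace.coord x : DefSpace.idx M X → M) ∘ a.symm)
          ((DefSpace.coord y : DefSpace.idx M Y → M) ∘ b.symm) ∘ Sum.inl) ∘ a =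
            DefSpace.coord x := by ext j; simp
        have h2 : (Sum.elim ((DefSpace.coord x : DefSpace.idx M X → M) ∘ a.symm)
          ((DefSpace.coord y : DefSpace.idx M Y → M) ∘ b.symm) ∘ Sum.inr) ∘ b =
            DefSpace.coord y := by ext j; simp
        simp only [S, mem_ofPred_eq, h1, h2, Homeomorph.symm_apply_apply]
        exact hy
      · simp
    have := hfS _ hx
    beta_reduce
    rw [hgf _ hx]
    have h1 : (Sum.elim ((DefSpace.coord x : DefSpace.idx M X → M) ∘ a.symm)
        (f ((DefSpace.coord x : DefSpace.idx M X → M) ∘ a.symm)) ∘ Sum.inl) ∘ a =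
          DefSpace.coord x := by ext j; simp
    simpa only [S, mem_ofPred_eq, h1, Homeomorph.symm_apply_apply, Sum.elim_comp_inr] using this

variable [NoMinOrder M] [NoMaxOrder M] [OrderTopology M]

section Nhds
open DefSpace

/-- Boxes in the coordinates form a basis of neighbourhoods, so that neighbourhoods can be
quantified over in a definable way. -/
lemma eventually_nhds_iff_box {s : X → Prop} {x : X} : (∀ᶠ z in 𝓝 x, s z) ↔
    ∃ l r : idx M X → M, (∀ i, l i < (coord x : idx M X → M) i ∧ (coord x : idx M X → M) i < r i) ∧
      ∀ z, (∀ i, l i < (coord z : idx M X → M) i ∧ (coord z : idx M X → M) i < r i) → s z := by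
  have hx : (∀ᶠ z in 𝓝 x, s z) ↔
      ∀ᶠ v in 𝓝 (coord x : idx M X → M), s (coord.symm v) := by
    rw [← (coord (M := M) (X := X)).map_nhds_eq, eventually_map]
    simp
  rw [hx]
  constructor
  · intro h
    rw [nhds_pi] at h
    obtain ⟨⟨I, f⟩, ⟨-, hf⟩, hI⟩ :=
      ((hasBasis_pi fun i => nhds_basis_Ioo ((coord x : idx M X → M) i)).eventually_iff).1 h
    have : ∀ i, ∃ b : M × M, (b.1 < (coord x : idx M X → M) i ∧ (coord x : idx M X → M) i < b.2) ∧
        (i ∈ I → b = f i) := by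
      intro i
      by_cases hi : i ∈ I
      · exact ⟨f i, hf i hi, fun _ => rfl⟩
      · obtain ⟨l, hl⟩ := exists_lt ((coord x : idx M X → M) i)
        obtain ⟨r, hr⟩ := exists_gt ((coord x : idx M X → M) i)
        exact ⟨(l, r), ⟨hl, hr⟩, fun h => absurd h hi⟩
    choose b hb hbI using this
    refine ⟨fun i => (b i).1, fun i => (b i).2, hb, fun z hz => ?_⟩
    have := hI (x := coord z) (fun i hi => by
      have := hz i
      simpa only [← hbI i hi, mem_Ioo] using this)
    simpa using this
  · rintro ⟨l, r, hlr, h⟩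
    have : ∀ᶠ v in 𝓝 (coord x : idx M X → M), ∀ i, l i < v i ∧ v i < r i :=
      eventually_all.2 fun i =>
        ((continuous_apply i).tendsto (coord x : idx M X → M)).eventually
          (Ioo_mem_nhds (hlr i).1 (hlr i).2)
    filter_upwards [this] with v hv
    exact h _ (by simpa using hv)

@[fun_prop]
lemma DP.eventually_nhds {s : P → X → Prop} {g : P → X}
    (hs : DP L M (fun q : P × X => s q.1 q.2)) (hg : DF L M g) :
    DP L M (fun q => ∀ᶠ z in 𝓝 (g q), s q z) := by
  have hc : DF L M (coord : X → idx M X → M) := df_coord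
  simp only [eventually_nhds_iff_box (M := M)]
  refine DP.ex (DP.ex (DP.and ?_ (DP.all (DP.imp ?_ ?_))))
  · refine DP.all_fin fun i => ?_
    fun_prop
  · refine DP.all_fin fun i => ?_
    fun_prop
  · fun_prop

end Nhds

/-- For a definable family of maps `h q : X → M`, continuity of `h q` at `g q` is a definable
condition on `q`. -/
@[fun_prop]
lemma DP.continuousAt {h : P → X → M} {g : P → X}
    (hh : DF L M (fun q : P × X => h q.1 q.2)) (hg : DF L M g) :
    DP L M (fun q => ContinuousAt (h q) (g q)) := by
  have : ∀ q, ContinuousAt (h q) (g q) ↔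
      (∀ u, u < h q (g q) → ∀ᶠ z in 𝓝 (g q), u < h q z) ∧
      (∀ u, h q (g q) < u → ∀ᶠ z in 𝓝 (g q), h q z < u) := fun q => tendsto_order
  simp only [this]
  refine DP.and (DP.all (DP.imp ?_ ?_)) (DP.all (DP.imp ?_ ?_)) <;> fun_prop

end OMin

section OneVariable

variable {L : Language} {M : Type*} [LinearOrder M] [TopologicalSpace M] [L.Structure M]

/-! ### The reversed order -/

instance : L.Structure Mᵒᵈ := inferInstanceAs (L.Structure M)

variable [OM L M]

/-- The standing assumptions are invariant under reversing the order, which gives access to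
mirror images of one-variable statements. -/
instance : OM L Mᵒᵈ where
  omin X hX := by
    have hM : IsOMinimal L M := OM.omin
    obtain ⟨𝒮, h𝒮, hI, hX⟩ := hM X hX
    refine ⟨𝒮, h𝒮, fun I hI' => ?_, hX⟩
    rcases hI I hI' with h | ⟨a, b, hab, h⟩ | ⟨a, h⟩ | ⟨a, h⟩ | h
    · exact Or.inl h
    · exact Or.inr (Or.inl ⟨b, a, hab, h.trans (by ext; exact and_comm)⟩)
    · exact Or.inr (Or.inr (Or.inr (Or.inl ⟨a, h⟩)))
    · exact Or.inr (Or.inr (Or.inl ⟨a, h⟩))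
    · exact Or.inr (Or.inr (Or.inr (Or.inr h)))
  lt := by
    have : DP L M (fun q : M × M => q.2 < q.1) := by fun_prop
    exact this
  choice := by
    have h : HasDefinableChoice L M := OM.choice
    exact h

/-! ### Definable sets in one variable -/

lemma exists_finite_cover {p : M → Prop} (hp : DP L M p) :
    ∃ 𝒮 : Set (Set M), 𝒮.Finite ∧ (∀ I ∈ 𝒮, (∃ a : M, I = {a}) ∨ IsInterval I) ∧
      {x | p x} = ⋃₀ 𝒮 :=
  OM.omin _ (definable₁_of_dp hp)

lemma IsInterval.ordConnected {I : Set M} (hI : IsInterval I) : I.OrdConnected := by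
  rcases hI with ⟨a, b, -, rfl⟩ | ⟨a, rfl⟩ | ⟨a, rfl⟩ | rfl <;> infer_instance

/-- Along a filter that decides order-convex sets, a definable predicate has a constant truth
value. -/
lemma eventually_or_of_ordConnected {p : M → Prop} (hp : DP L M p) {l : Filter M}
    (hl : ∀ I : Set M, I.OrdConnected → (∀ᶠ y in l, y ∈ I) ∨ ∀ᶠ y in l, y ∉ I) :
    (∀ᶠ y in l, p y) ∨ ∀ᶠ y in l, ¬ p y := by
  obtain ⟨𝒮, h𝒮, hI, hX⟩ := exists_finite_cover hp
  have hpI : ∀ y, p y ↔ ∃ I ∈ 𝒮, y ∈ I := fun y => by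
    have : y ∈ {x | p x} ↔ y ∈ ⋃₀ 𝒮 := by rw [hX]
    simpa using this
  by_cases h : ∃ I ∈ 𝒮, ∀ᶠ y in l, y ∈ I
  · obtain ⟨I, hI𝒮, h⟩ := h
    exact Or.inl (h.mono fun y hy => (hpI y).2 ⟨I, hI𝒮, hy⟩)
  · right
    replace h : ∀ I ∈ 𝒮, ¬ ∀ᶠ y in l, y ∈ I := fun I hI𝒮 h' => h ⟨I, hI𝒮, h'⟩
    have : ∀ᶠ y in l, ∀ I ∈ 𝒮, y ∉ I := by
      rw [eventually_all_finite h𝒮]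
      intro I hI𝒮
      refine (hl I ?_).resolve_left (h I hI𝒮)
      rcases hI I hI𝒮 with ⟨a, rfl⟩ | h
      · exact ordConnected_singleton
      · exact h.ordConnected
    refine this.mono fun y hy => ?_
    rw [hpI]
    push Not
    exact hy

variable [DenselyOrdered M] [NoMinOrder M] [NoMaxOrder M] [OrderTopology M]

/-- A definable predicate has a constant truth value just to the right of a point. -/
lemma eventually_nhdsGT_or {p : M → Prop} (hp : DP L M p) (x : M) :
    (∀ᶠ y in 𝓝[>] x, p y) ∨ ∀ᶠ y in 𝓝[>] x, ¬ p y := by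
  refine eventually_or_of_ordConnected hp fun I hI => ?_
  by_cases h : ∃ᶠ y in 𝓝[>] x, y ∈ I
  · left
    obtain ⟨y, hy, hxy⟩ := (h.and_eventually self_mem_nhdsWithin).exists
    filter_upwards [Ioo_mem_nhdsGT hxy] with z hz
    obtain ⟨y', hy', hxy'⟩ := (h.and_eventually (Ioo_mem_nhdsGT hz.1)).exists
    exact hI.out hy' hy ⟨hxy'.2.le, hz.2.le⟩
  · right
    simpa using h

/-- A definable predicate has a constant truth value just to the left of a point. -/
lemma eventually_nhdsLT_or {p : M → Prop} (hp : DP L M p) (x : M) :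
    (∀ᶠ y in 𝓝[<] x, p y) ∨ ∀ᶠ y in 𝓝[<] x, ¬ p y := by
  have hp' : DP L Mᵒᵈ (fun x : Mᵒᵈ => p x) := hp
  exact eventually_nhdsGT_or hp' x

/-- An infinite definable set contains an interval. -/
lemma exists_Ioo_subset_of_infinite {p : M → Prop} (hp : DP L M p) (hinf : {x | p x}.Infinite) :
    ∃ a b, a < b ∧ ∀ x ∈ Ioo a b, p x := by
  obtain ⟨𝒮, h𝒮, hI, hX⟩ := exists_finite_cover hp
  rw [hX] at hinf
  have : ∃ I ∈ 𝒮, I.Infinite := by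
    by_contra! h
    exact hinf (h𝒮.sUnion h)
  obtain ⟨I, hI𝒮, hIinf⟩ := this
  have hIp : ∀ x ∈ I, p x := fun x hx => by
    have : x ∈ ⋃₀ 𝒮 := ⟨I, hI𝒮, hx⟩
    rwa [← hX] at this
  suffices ∃ a b, a < b ∧ Ioo a b ⊆ I from
    this.imp fun a => Exists.imp fun b h => ⟨h.1, fun x hx => hIp x (h.2 hx)⟩
  obtain ⟨z, -⟩ := hIinf.nonempty
  rcases hI I hI𝒮 with ⟨a, rfl⟩ | ⟨a, b, hab, rfl⟩ | ⟨a, rfl⟩ | ⟨a, rfl⟩ | rfl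
  · exact absurd (finite_singleton a) hIinf
  · exact ⟨a, b, hab, subset_rfl⟩
  · obtain ⟨b, hb⟩ := exists_lt a
    exact ⟨b, a, hb, Ioo_subset_Iio_self⟩
  · obtain ⟨b, hb⟩ := exists_gt a
    exact ⟨a, b, hb, Ioo_subset_Ioi_self⟩
  · obtain ⟨b, hb⟩ := exists_gt z
    exact ⟨z, b, hb, subset_univ _⟩

/-- Nonempty definable sets that are bounded below have an infimum. -/
lemma exists_isGLB {p : M → Prop} (hp : DP L M p) (hne : ∃ x, p x)
    (hbdd : ∃ b, ∀ x, p x → b ≤ x) : ∃ g, IsGLB {x | p x} g := by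
  obtain ⟨𝒮, h𝒮, hI, hX⟩ := exists_finite_cover hp
  have hne' : (⋃₀ 𝒮).Nonempty := by
    rw [← hX]
    exact hne
  have hbdd' : BddBelow (⋃₀ 𝒮) := by
    rw [← hX]
    exact hbdd
  rw [hX]
  clear hX hne hbdd
  induction 𝒮, h𝒮 using Set.Finite.induction_on with
  | empty => simp at hne'
  | @insert I 𝒮 _ _ ih =>
    rw [sUnion_insert] at hne' hbdd' ⊢
    have h1 : I.Nonempty → ∃ g, IsGLB I g := by
      intro hIne
      have hIb : BddBelow I := hbdd'.mono subset_union_left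
      rcases hI I (mem_insert _ _) with ⟨a, rfl⟩ | ⟨a, b, hab, rfl⟩ | ⟨a, rfl⟩ | ⟨a, rfl⟩ | rfl
      · exact ⟨a, isGLB_singleton⟩
      · exact ⟨a, isGLB_Ioo hab⟩
      · exact absurd hIb (not_bddBelow_Iio a)
      · exact ⟨a, isGLB_Ioi⟩
      · exact absurd hIb not_bddBelow_univ
    have h2 : (⋃₀ 𝒮).Nonempty → ∃ g, IsGLB (⋃₀ 𝒮) g := fun h =>
      ih (fun J hJ => hI J (mem_insert_of_mem _ hJ)) h (hbdd'.mono subset_union_right)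
    rcases I.eq_empty_or_nonempty with rfl | hI1
    · simpa using h2 (by simpa using hne')
    · rcases (⋃₀ 𝒮).eq_empty_or_nonempty with h0 | hI2
      · rw [h0, union_empty]
        exact h1 hI1
      · obtain ⟨g, hg⟩ := h1 hI1
        obtain ⟨g', hg'⟩ := h2 hI2
        exact ⟨_, hg.union hg'⟩

/-- Nonempty definable sets that are bounded above have a supremum. -/
lemma exists_isLUB {p : M → Prop} (hp : DP L M p) (hne : ∃ x, p x)
    (hbdd : ∃ b, ∀ x, p x → x ≤ b) : ∃ g, IsLUB {x | p x} g := by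
  have hp' : DP L Mᵒᵈ (fun x : Mᵒᵈ => p x) := hp
  exact exists_isGLB hp' hne hbdd

@[fun_prop]
lemma DP.eventually_nhdsGT {P : Type*} [TopologicalSpace P] [DefSpace M P] {s : P → M → Prop}
    {g : P → M} (hs : DP L M (fun q : P × M => s q.1 q.2)) (hg : DF L M g) :
    DP L M (fun q => ∀ᶠ z in 𝓝[>] (g q), s q z) := by
  simp only [eventually_nhdsWithin_iff, mem_Ioi]
  refine DP.eventually_nhds (DP.imp ?_ ?_) hg <;> fun_prop

@[fun_prop]
lemma DP.eventually_nhdsLT {P : Type*} [TopologicalSpace P] [DefSpace M P] {s : P → M → Prop}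
    {g : P → M} (hs : DP L M (fun q : P × M => s q.1 q.2)) (hg : DF L M g) :
    DP L M (fun q => ∀ᶠ z in 𝓝[<] (g q), s q z) := by
  simp only [eventually_nhdsWithin_iff, mem_Iio]
  refine DP.eventually_nhds (DP.imp ?_ ?_) hg <;> fun_prop

@[fun_prop]
lemma DP.mem_Ioo {P : Type*} [TopologicalSpace P] [DefSpace M P] {f g h : P → M}
    (hf : DF L M f) (hg : DF L M g) (hh : DF L M h) : DP L M (fun q => f q ∈ Ioo (g q) (h q)) := by
  simp only [Set.mem_Ioo]
  fun_prop

/-! ### The monotonicity theorem -/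

section StrictOrder

variable {r : M → M → Prop} {a b : M}

lemma exists_Ioo_left_of_eventually {p : M → Prop} {e x : M} (he : e < x)
    (h : ∀ᶠ y in 𝓝[<] x, p y) : ∃ u, e ≤ u ∧ u < x ∧ ∀ y ∈ Ioo u x, p y := by
  obtain ⟨u, hu, h⟩ := (mem_nhdsLT_iff_exists_Ioo_subset' he).1 h
  exact ⟨max e u, le_max_left _ _, max_lt he hu,
    fun y hy => h ⟨(le_max_right _ _).trans_lt hy.1, hy.2⟩⟩

/-- Let `r` be a definable strict linear order on `(a, b)` in which every point is a strict local
minimum. Then near the end `b` of the interval, every point is a jump: all values just to the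
right are below all values just to the left. The jumps arise as the last places `β` where the
values fall below the value at a given point `c`. -/
lemma exists_jumps (hr : DP L M (fun q : M × M => r q.1 q.2)) (irr : ∀ x, ¬ r x x)
    (tr : ∀ {x y z}, r x y → r y z → r x z)
    (tot : ∀ x ∈ Ioo a b, ∀ y ∈ Ioo a b, x ≠ y → r x y ∨ r y x) (hab : a < b)
    (hright : ∀ x ∈ Ioo a b, ∀ᶠ y in 𝓝[>] x, r x y)
    (hleft : ∀ x ∈ Ioo a b, ∀ᶠ y in 𝓝[<] x, r x y) :
    ∃ a', a ≤ a' ∧ a' < b ∧ ∀ x ∈ Ioo a' b,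
      ∃ u w, u < x ∧ x < w ∧ ∀ y z, y ∈ Ioo u x → z ∈ Ioo x w → r z y := by
  -- Not all points near `b` can lie below everything that follows.
  have hB : ∃ e, a ≤ e ∧ e < b ∧ ∀ x ∈ Ioo e b, ∃ y ∈ Ioo x b, r y x := by
    have hdp : DP L M (fun x => ∀ y, y ∈ Ioo x b → r x y) := by
      refine DP.all (DP.imp ?_ ?_) <;> fun_prop
    rcases eventually_nhdsLT_or hdp b with h | h
    · obtain ⟨e, hae, heb, h⟩ := exists_Ioo_left_of_eventually hab h
      obtain ⟨x, hx⟩ := exists_between heb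
      have hx' : x ∈ Ioo a b := ⟨hae.trans_lt hx.1, hx.2⟩
      obtain ⟨y, hy1, hy2⟩ := ((hleft x hx').and (Ioo_mem_nhdsLT hx.1)).exists
      exact absurd (tr hy1 (h y ⟨hy2.1, hy2.2.trans hx.2⟩ x ⟨hy2.2, hx.2⟩)) (irr x)
    · obtain ⟨e, hae, heb, h⟩ := exists_Ioo_left_of_eventually hab h
      refine ⟨e, hae, heb, fun x hx => ?_⟩
      have := h x hx
      push Not at this
      obtain ⟨y, hy, hxy⟩ := this
      exact ⟨y, hy, (tot x ⟨hae.trans_lt hx.1, hx.2⟩ y ⟨hae.trans_lt (hx.1.trans hy.1), hy.2⟩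
        hy.1.ne).resolve_left hxy⟩
  obtain ⟨e, hae, heb, hB⟩ := hB
  have hin : ∀ {x}, e < x → x < b → x ∈ Ioo a b := fun h h' => ⟨hae.trans_lt h, h'⟩
  -- The values near `b` lie below each given value.
  have hend : ∀ c ∈ Ioo e b, ∀ᶠ y in 𝓝[<] b, r y c := by
    intro c hc
    have hdp : DP L M (fun y => r y c) := by fun_prop
    refine (eventually_nhdsLT_or hdp b).resolve_right fun h => ?_
    obtain ⟨d', hcd', hd'b, h⟩ := exists_Ioo_left_of_eventually hc.2 h
    have hZ : DP L M (fun y => c < y ∧ y < b ∧ r y c) := by fun_prop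
    obtain ⟨y0, hy0, hy0c⟩ := hB c hc
    have hbd : ∀ y, c < y ∧ y < b ∧ r y c → y ≤ d' := fun y hy =>
      not_lt.1 fun hlt => h y ⟨hlt, hy.2.1⟩ hy.2.2
    obtain ⟨d, hd⟩ := exists_isLUB hZ ⟨y0, hy0.1, hy0.2, hy0c⟩ ⟨d', hbd⟩
    have hcd : c < d := hy0.1.trans_le (hd.1 ⟨hy0.1, hy0.2, hy0c⟩)
    have hdb : d < b := (hd.2 hbd).trans_lt hd'b
    by_cases hdc : r d c
    · obtain ⟨y, hy, hyd⟩ := hB d ⟨hc.1.trans hcd, hdb⟩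
      exact absurd (hd.1 ⟨hcd.trans hy.1, hy.2, tr hyd hdc⟩) (not_le.2 hy.1)
    · obtain ⟨u, -, hud, hu⟩ := exists_Ioo_left_of_eventually hcd
        (hleft d (hin (hc.1.trans hcd) hdb))
      obtain ⟨y, hy, huy, hyd⟩ := hd.exists_between hud
      have hyd' : y < d := lt_of_le_of_ne hyd fun h => hdc (h ▸ hy.2.2)
      exact hdc (tr (hu y ⟨huy, hyd'⟩) hy.2.2)
  have hdpJ : DP L M (fun x => ∃ u w, u < x ∧ x < w ∧
      ∀ y z, y ∈ Ioo u x → z ∈ Ioo x w → r z y) := by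
    refine DP.ex (DP.ex (DP.and ?_ (DP.and ?_ (DP.all (DP.all (DP.imp ?_ (DP.imp ?_ ?_))))))) <;>
      fun_prop
  -- There are jumps arbitrarily close to `b`.
  have hjump : ∀ c ∈ Ioo e b, ∃ x ∈ Ioo c b, ∃ u w, u < x ∧ x < w ∧
      ∀ y z, y ∈ Ioo u x → z ∈ Ioo x w → r z y := by
    intro c hc
    have hZ : DP L M (fun y => c < y ∧ y < b ∧ r c y) := by fun_prop
    obtain ⟨y0, hy0c, hy0⟩ := ((hright c (hin hc.1 hc.2)).and (Ioo_mem_nhdsGT hc.2)).exists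
    obtain ⟨d', hcd', hd'b, h⟩ := exists_Ioo_left_of_eventually hc.2 (hend c hc)
    have hbd : ∀ y, c < y ∧ y < b ∧ r c y → y ≤ d' := fun y hy =>
      not_lt.1 fun hlt => irr c (tr hy.2.2 (h y ⟨hlt, hy.2.1⟩))
    obtain ⟨d, hd⟩ := exists_isLUB hZ ⟨y0, hy0.1, hy0.2, hy0c⟩ ⟨d', hbd⟩
    have hcd : c < d := hy0.1.trans_le (hd.1 ⟨hy0.1, hy0.2, hy0c⟩)
    have hdb : d < b := (hd.2 hbd).trans_lt hd'b
    have hright' : ∀ z ∈ Ioo d b, r z c := fun z hz =>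
      (tot c (hin hc.1 hc.2) z (hin (hc.1.trans (hcd.trans hz.1)) hz.2)
        (hcd.trans hz.1).ne).resolve_left fun hcz =>
          absurd (hd.1 ⟨hcd.trans hz.1, hz.2, hcz⟩) (not_le.2 hz.1)
    have hdp : DP L M (fun y => r c y) := by fun_prop
    rcases eventually_nhdsLT_or hdp d with h | h
    · obtain ⟨u, -, hud, hu⟩ := exists_Ioo_left_of_eventually hcd h
      exact ⟨d, ⟨hcd, hdb⟩, u, b, hud, hdb, fun y z hy hz => tr (hright' z hz) (hu y hy)⟩
    · exfalso
      obtain ⟨u, -, hud, hu⟩ := exists_Ioo_left_of_eventually hcd h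
      obtain ⟨y, hy, huy, hyd⟩ := hd.exists_between hud
      have hyd' : y = d := by
        by_contra hne
        exact hu y ⟨huy, lt_of_le_of_ne hyd hne⟩ hy.2.2
      subst hyd'
      obtain ⟨y', hy', hcy'⟩ := ((hleft y (hin (hc.1.trans hcd) hdb)).and h).exists
      exact hcy' (tr hy.2.2 hy')
  rcases eventually_nhdsLT_or hdpJ b with h | h
  · obtain ⟨u, hu, hub, h⟩ := exists_Ioo_left_of_eventually heb h
    exact ⟨u, hae.trans hu, hub, h⟩
  · obtain ⟨u, hu, hub, h⟩ := exists_Ioo_left_of_eventually heb h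
    obtain ⟨c, hc⟩ := exists_between hub
    obtain ⟨x, hx, hx'⟩ := hjump c ⟨hu.trans_lt hc.1, hc.2⟩
    exact absurd hx' (h x ⟨hc.1.trans hx.1, hx.2⟩)

/-- In a definable strict linear order on an interval, not every point is a strict local
minimum: otherwise some point would be both a downward and an upward jump. -/
lemma not_forall_local_min (hr : DP L M (fun q : M × M => r q.1 q.2)) (irr : ∀ x, ¬ r x x)
    (tr : ∀ {x y z}, r x y → r y z → r x z)
    (tot : ∀ x ∈ Ioo a b, ∀ y ∈ Ioo a b, x ≠ y → r x y ∨ r y x) (hab : a < b)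
    (hright : ∀ x ∈ Ioo a b, ∀ᶠ y in 𝓝[>] x, r x y)
    (hleft : ∀ x ∈ Ioo a b, ∀ᶠ y in 𝓝[<] x, r x y) : False := by
  obtain ⟨a', haa', ha'b, h1⟩ := exists_jumps hr irr tr tot hab hright hleft
  have hsub : ∀ {x}, x ∈ Ioo a' b → x ∈ Ioo a b := fun hx => ⟨haa'.trans_lt hx.1, hx.2⟩
  have hr' : DP L Mᵒᵈ (fun q : Mᵒᵈ × Mᵒᵈ => r q.1 q.2) := hr
  have hmirror : ∃ b' : M, b' ≤ b ∧ a' < b' ∧ ∀ x ∈ Ioo a' b', ∃ w u, x < w ∧ u < x ∧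
      ∀ z y, z ∈ Ioo x w → y ∈ Ioo u x → r y z := by
    obtain ⟨b', hbb', ha'b', h2⟩ := exists_jumps (M := Mᵒᵈ) (a := b) (b := a') hr' irr
      tr (fun x hx y hy => tot x (hsub hx.symm) y (hsub hy.symm)) ha'b
      (fun x hx => hleft x (hsub hx.symm)) (fun x hx => hright x (hsub hx.symm))
    refine ⟨b', hbb', ha'b', fun x hx => ?_⟩
    obtain ⟨w, u, hw, hu, h⟩ := h2 x hx.symm
    exact ⟨w, u, hw, hu, fun z y hz hy => h z y hz.symm hy.symm⟩
  obtain ⟨b', hbb', ha'b', h2⟩ := hmirror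
  obtain ⟨x, hx⟩ := exists_between ha'b'
  obtain ⟨u, w, hu, hw, h1⟩ := h1 x ⟨hx.1, hx.2.trans_le hbb'⟩
  obtain ⟨w', u', hw', hu', h2⟩ := h2 x hx
  obtain ⟨y, hy⟩ := exists_between (max_lt hu hu')
  obtain ⟨z, hz⟩ := exists_between (lt_min hw hw')
  rw [max_lt_iff] at hy
  rw [lt_min_iff] at hz
  exact irr y (tr (h2 z y ⟨hz.1, hz.2.2⟩ ⟨hy.1.2, hy.2⟩) (h1 y z ⟨hy.1.1, hy.2⟩ ⟨hz.1, hz.2.1⟩))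

/-- A definable strict linear order on an interval that is locally increasing at every point is
increasing. -/
lemma increasing_of_locally_increasing (hr : DP L M (fun q : M × M => r q.1 q.2))
    (tr : ∀ {x y z}, r x y → r y z → r x z)
    (hright : ∀ x ∈ Ioo a b, ∀ᶠ y in 𝓝[>] x, r x y)
    (hleft : ∀ x ∈ Ioo a b, ∀ᶠ y in 𝓝[<] x, r y x) :
    ∀ x ∈ Ioo a b, ∀ y ∈ Ioo a b, x < y → r x y := by
  intro x hx x' hx' hxx'
  by_contra hcon
  have hZ : DP L M (fun y => x < y ∧ y < b ∧ ¬ r x y) := by fun_prop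
  obtain ⟨g, hg⟩ := exists_isGLB hZ ⟨x', hxx', hx'.2, hcon⟩ ⟨x, fun y hy => hy.1.le⟩
  have hgx' : g ≤ x' := hg.1 ⟨hxx', hx'.2, hcon⟩
  have hxg : x < g := by
    refine lt_of_le_of_ne (hg.2 fun y hy => hy.1.le) ?_
    rintro rfl
    obtain ⟨w, hw, h⟩ := (mem_nhdsGT_iff_exists_Ioo_subset' hxx').1 (hright x hx)
    obtain ⟨y, hy, hxy, hyw⟩ := hg.exists_between hw
    exact hy.2.2 (h ⟨hy.1, hyw⟩)
  have hgI : g ∈ Ioo a b := ⟨hx.1.trans hxg, hgx'.trans_lt hx'.2⟩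
  obtain ⟨y, hyg, hy⟩ := ((hleft g hgI).and (Ioo_mem_nhdsLT hxg)).exists
  have hxy : r x y := by
    by_contra h
    exact absurd (hg.1 ⟨hy.1, hy.2.trans hgI.2, h⟩) (not_le.2 hy.2)
  have hrxg : r x g := tr hxy hyg
  have hgx'' : g < x' := lt_of_le_of_ne hgx' fun h => hcon (h ▸ hrxg)
  obtain ⟨w, hw, h⟩ := (mem_nhdsGT_iff_exists_Ioo_subset' hgx'').1 (hright g hgI)
  obtain ⟨z, hz, hgz, hzw⟩ := hg.exists_between hw
  have hgz' : g < z := lt_of_le_of_ne hgz fun h => hz.2.2 (h ▸ hrxg)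
  exact hz.2.2 (tr hrxg (h ⟨hgz', hzw⟩))

/-- A definable predicate has constant truth value on a subinterval of a given interval. -/
lemma exists_subinterval {p : M → Prop} (hp : DP L M p) (hab : a < b) :
    ∃ a' b', a' < b' ∧ Ioo a' b' ⊆ Ioo a b ∧
      ((∀ x ∈ Ioo a' b', p x) ∨ ∀ x ∈ Ioo a' b', ¬ p x) := by
  rcases eventually_nhdsLT_or hp b with h | h <;>
  · obtain ⟨u, hu, hub, h⟩ := exists_Ioo_left_of_eventually hab h
    exact ⟨u, b, hub, Ioo_subset_Ioo_left hu, by tauto⟩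

/-- A definable strict linear order on an interval agrees with the order of `M`, or with the
reverse order, on a subinterval. -/
lemma exists_subinterval_monotone (hr : DP L M (fun q : M × M => r q.1 q.2))
    (irr : ∀ x, ¬ r x x) (tr : ∀ {x y z}, r x y → r y z → r x z)
    (tot : ∀ x ∈ Ioo a b, ∀ y ∈ Ioo a b, x ≠ y → r x y ∨ r y x) (hab : a < b) :
    ∃ a' b', a' < b' ∧ Ioo a' b' ⊆ Ioo a b ∧
      ((∀ x ∈ Ioo a' b', ∀ y ∈ Ioo a' b', x < y → r x y) ∨
        ∀ x ∈ Ioo a' b', ∀ y ∈ Ioo a' b', x < y → r y x) := by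
  have hp1 : DP L M (fun x => ∀ᶠ y in 𝓝[>] x, r x y) := by fun_prop
  have hp2 : DP L M (fun x => ∀ᶠ y in 𝓝[<] x, r x y) := by fun_prop
  obtain ⟨a1, b1, h1, hs1, c1⟩ := exists_subinterval hp1 hab
  obtain ⟨a2, b2, h2, hs2, c2⟩ := exists_subinterval hp2 h1
  have hs := hs2.trans hs1
  have tot' : ∀ x ∈ Ioo a2 b2, ∀ y ∈ Ioo a2 b2, x ≠ y → r x y ∨ r y x :=
    fun x hx y hy => tot x (hs hx) y (hs hy)
  have hneg1 : ∀ x ∈ Ioo a2 b2, ¬ (∀ᶠ y in 𝓝[>] x, r x y) → ∀ᶠ y in 𝓝[>] x, r y x := by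
    intro x hx h
    have hdp : DP L M (fun y => r x y) := by fun_prop
    filter_upwards [(eventually_nhdsGT_or hdp x).resolve_left h, Ioo_mem_nhdsGT hx.2] with y hy hxy
    exact (tot' x hx y ⟨hx.1.trans hxy.1, hxy.2⟩ hxy.1.ne).resolve_left hy
  have hneg2 : ∀ x ∈ Ioo a2 b2, ¬ (∀ᶠ y in 𝓝[<] x, r x y) → ∀ᶠ y in 𝓝[<] x, r y x := by
    intro x hx h
    have hdp : DP L M (fun y => r x y) := by fun_prop
    filter_upwards [(eventually_nhdsLT_or hdp x).resolve_left h, Ioo_mem_nhdsLT hx.1] with y hy hxy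
    exact (tot' x hx y ⟨hxy.1, hxy.2.trans hx.2⟩ hxy.2.ne').resolve_left hy
  refine ⟨a2, b2, h2, hs, ?_⟩
  have hr' : DP L M (fun q : M × M => r q.2 q.1) := by fun_prop
  rcases c1 with c1 | c1 <;> rcases c2 with c2 | c2
  · exact (not_forall_local_min hr irr tr tot' h2 (fun x hx => c1 x (hs2 hx)) c2).elim
  · exact Or.inl (increasing_of_locally_increasing hr tr (fun x hx => c1 x (hs2 hx))
      fun x hx => hneg2 x hx (c2 x hx))
  · exact Or.inr (increasing_of_locally_increasing (r := fun x y => r y x) hr'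
      (fun h h' => tr h' h) (fun x hx => hneg1 x hx (c1 x (hs2 hx))) c2)
  · exact (not_forall_local_min (r := fun x y => r y x) hr' irr
      (fun h h' => tr h' h) (fun x hx y hy h => (tot' x hx y hy h).symm) h2
      (fun x hx => hneg1 x hx (c1 x (hs2 hx))) fun x hx => hneg2 x hx (c2 x hx)).elim

end StrictOrder

/-- A definable function is constant or injective on a subinterval of a given interval. -/
lemma exists_subinterval_const_or_injOn [Nonempty M] {f : M → M} (hf : DF L M f) {a b : M}
    (hab : a < b) : ∃ a' b', a' < b' ∧ Ioo a' b' ⊆ Ioo a b ∧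
      ((∃ c, ∀ x ∈ Ioo a' b', f x = c) ∨ InjOn f (Ioo a' b')) := by
  have hsub : ∀ {a' b'}, a' < b' → (∀ x ∈ Ioo a' b', x ∈ Ioo a b) → Ioo a' b' ⊆ Ioo a b :=
    fun _ h x hx => h x hx
  by_cases hfib : ∃ c, {x | x ∈ Ioo a b ∧ f x = c}.Infinite
  · obtain ⟨c, hc⟩ := hfib
    obtain ⟨a', b', h, h'⟩ := exists_Ioo_subset_of_infinite (L := L) (by fun_prop) hc
    exact ⟨a', b', h, fun x hx => (h' x hx).1, Or.inl ⟨c, fun x hx => (h' x hx).2⟩⟩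
  -- Otherwise the image is infinite, and a definable section of `f` has an infinite image,
  -- on which `f` is injective.
  push Not at hfib
  have hdp : DP L M (fun q : M × M => q.2 ∈ Ioo a b ∧ f q.2 = q.1) := by fun_prop
  obtain ⟨g, hg, hgf⟩ := exists_df_choice (p := fun c x => x ∈ Ioo a b ∧ f x = c) hdp
  have himg : (f '' Ioo a b).Infinite := by
    intro hfin
    refine (Ioo_infinite hab) ((hfin.biUnion fun c _ => hfib c).subset fun x hx => ?_)
    simp only [mem_iUnion]
    exact ⟨f x, mem_image_of_mem _ hx, hx, rfl⟩
  have hginj : InjOn g (f '' Ioo a b) := by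
    rintro c ⟨x, hx, hxc⟩ d ⟨y, hy, hyd⟩ h
    rw [← (hgf c ⟨x, hx, hxc⟩).2, ← (hgf d ⟨y, hy, hyd⟩).2, h]
  have hgimg : {x | x ∈ Ioo a b ∧ g (f x) = x}.Infinite := by
    refine (himg.image hginj).mono ?_
    rintro _ ⟨c, ⟨x, hx, hxc⟩, rfl⟩
    obtain ⟨h1, h2⟩ := hgf c ⟨x, hx, hxc⟩
    exact ⟨h1, by rw [h2]⟩
  obtain ⟨a', b', h, h'⟩ := exists_Ioo_subset_of_infinite (L := L) (by fun_prop) hgimg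
  refine ⟨a', b', h, fun x hx => (h' x hx).1, Or.inr fun x hx y hy hxy => ?_⟩
  rw [← (h' x hx).2, ← (h' y hy).2, hxy]

/-- A function that is strictly monotone on an interval, with an image that contains an interval,
is continuous on a subinterval. -/
lemma exists_subinterval_continuousOn {N : Type*} [LinearOrder N] [TopologicalSpace N]
    [OrderTopology N] [DenselyOrdered N] {f : M → N} {a b : M}
    (hmono : StrictMonoOn f (Ioo a b))
    (himg : ∃ c d, c < d ∧ Ioo c d ⊆ f '' Ioo a b) :
    ∃ a' b', a' < b' ∧ Ioo a' b' ⊆ Ioo a b ∧ ∀ x ∈ Ioo a' b', ContinuousAt f x := by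
  obtain ⟨c, d, hcd, h⟩ := himg
  obtain ⟨y, hcy, hyd⟩ := exists_between hcd
  obtain ⟨y', hyy', hy'd⟩ := exists_between hyd
  obtain ⟨x, hx, rfl⟩ := h ⟨hcy, hyd⟩
  obtain ⟨x', hx', rfl⟩ := h ⟨hcy.trans hyy', hy'd⟩
  have hsub : Ioo x x' ⊆ Ioo a b := Ioo_subset_Ioo hx.1.le hx'.2.le
  refine ⟨x, x', (hmono.lt_iff_lt hx hx').1 hyy', hsub, fun z hz => ?_⟩
  refine hmono.continuousAt_of_image_mem_nhds (Ioo_mem_nhds (hsub hz).1 (hsub hz).2) ?_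
  exact mem_of_superset (Ioo_mem_nhds (hcy.trans (hmono hx (hsub hz) hz.1))
    ((hmono (hsub hz) hx' hz.2).trans hy'd)) h

/-- The monotonicity theorem, in a weak form: a definable function is continuous and monotone or
antitone on a subinterval of a given interval. -/
theorem exists_subinterval_continuous_monotone [Nonempty M] {f : M → M} (hf : DF L M f) {a b : M}
    (hab : a < b) : ∃ a' b', a' < b' ∧ Ioo a' b' ⊆ Ioo a b ∧
      (∀ x ∈ Ioo a' b', ContinuousAt f x) ∧
      (MonotoneOn f (Ioo a' b') ∨ AntitoneOn f (Ioo a' b')) := by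
  obtain ⟨a1, b1, h1, hs1, ⟨c, hc⟩ | hinj⟩ := exists_subinterval_const_or_injOn hf hab
  · refine ⟨a1, b1, h1, hs1, fun x hx => ?_, Or.inl fun x hx y hy _ => ?_⟩
    · refine ContinuousAt.congr (f := fun _ => c) continuousAt_const ?_
      filter_upwards [Ioo_mem_nhds hx.1 hx.2] with y hy using (hc y hy).symm
    · rw [hc x hx, hc y hy]
  have himg : ∀ {a' b'}, a' < b' → Ioo a' b' ⊆ Ioo a1 b1 →
      ∃ c d, c < d ∧ Ioo c d ⊆ f '' Ioo a' b' := by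
    intro a' b' h hs
    have : (f '' Ioo a' b').Infinite := (Ioo_infinite h).image (hinj.mono hs)
    exact exists_Ioo_subset_of_infinite (L := L) (p := fun y => ∃ x, x ∈ Ioo a' b' ∧ f x = y)
      (by fun_prop) this
  obtain ⟨a2, b2, h2, hs2, h⟩ := exists_subinterval_monotone (L := L) (r := fun x y => f x < f y)
    (by fun_prop) (fun x => lt_irrefl _) (fun h h' => lt_trans h h')
    (fun x hx y hy hxy => lt_or_gt_of_ne fun h => hxy (hinj hx hy h)) h1
  rcases h with h | h
  · have hm : StrictMonoOn f (Ioo a2 b2) := fun x hx y hy => h x hx y hy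
    obtain ⟨a3, b3, h3, hs3, hc⟩ := exists_subinterval_continuousOn hm (himg h2 hs2)
    exact ⟨a3, b3, h3, hs3.trans (hs2.trans hs1), hc, Or.inl (hm.monotoneOn.mono hs3)⟩
  · have hm : StrictAntiOn f (Ioo a2 b2) := fun x hx y hy => h x hx y hy
    obtain ⟨a3, b3, h3, hs3, hc⟩ := exists_subinterval_continuousOn (N := Mᵒᵈ) (f := f) hm (by
      obtain ⟨c, d, hcd, h⟩ := himg h2 hs2
      exact ⟨d, c, hcd, fun y hy => h hy.symm⟩)
    exact ⟨a3, b3, h3, hs3.trans (hs2.trans hs1), hc, Or.inr (hm.antitoneOn.mono hs3)⟩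

end OneVariable

/-! ### Generic points -/

section Generic

variable {X : Type*} [TopologicalSpace X]

variable (X) in
/-- The filter of sets with dense interior. A property is generic if it holds on a dense open
set. -/
def generic : Filter X where
  sets := {s | Dense (interior s)}
  univ_sets := by simp
  sets_of_superset := fun h hst => h.mono (interior_mono hst)
  inter_sets := fun {s t} hs ht => by
    simp only [mem_ofPred_eq, interior_inter] at *
    exact hs.inter_of_isOpen_left ht isOpen_interior

lemma eventually_generic_iff {p : X → Prop} : (∀ᶠ x in generic X, p x) ↔
    ∀ W : Set X, IsOpen W → W.Nonempty → ∃ x ∈ W, ∀ᶠ z in 𝓝 x, p z := by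
  change Dense (interior {x | p x}) ↔ _
  rw [dense_iff_inter_open]
  refine forall_congr' fun W => forall_congr' fun _ => forall_congr' fun _ => ?_
  simp only [Set.Nonempty, mem_inter_iff, mem_interior_iff_mem_nhds]
  rfl

lemma exists_of_eventually_generic {p : X → Prop} (h : ∀ᶠ x in generic X, p x) {W : Set X}
    (hW : IsOpen W) (hne : W.Nonempty) : ∃ x ∈ W, p x :=
  (eventually_generic_iff.1 h W hW hne).imp fun _ hx => ⟨hx.1, hx.2.self_of_nhds⟩

end Generic

section Tame

variable {L : Language} {M : Type*} [LinearOrder M] [TopologicalSpace M] [L.Structure M]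
variable {X Y : Type*} [TopologicalSpace X] [TopologicalSpace Y] [DefSpace M X] [DefSpace M Y]

variable (L M X) in
/-- The generic behaviour of definable predicates and functions on `X`: near a generic point, a
definable predicate is constant and a definable function is continuous. -/
structure Tame : Prop where
  locConst : ∀ p : X → Prop, DP L M p →
    ∀ᶠ x in generic X, (∀ᶠ z in 𝓝 x, p z) ∨ ∀ᶠ z in 𝓝 x, ¬ p z
  cont : ∀ f : X → M, DF L M f → ∀ᶠ x in generic X, ContinuousAt f x

lemma locConst_of_dense {p : X → Prop} (h : ∀ W : Set X, IsOpen W → W.Nonempty →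
      ∃ x ∈ W, (∀ᶠ z in 𝓝 x, p z) ∨ ∀ᶠ z in 𝓝 x, ¬ p z) :
    ∀ᶠ x in generic X, (∀ᶠ z in 𝓝 x, p z) ∨ ∀ᶠ z in 𝓝 x, ¬ p z := by
  refine eventually_generic_iff.2 fun W hW hne => ?_
  obtain ⟨x, hx, h | h⟩ := h W hW hne
  · exact ⟨x, hx, h.eventually_nhds.mono fun z hz => Or.inl hz⟩
  · exact ⟨x, hx, h.eventually_nhds.mono fun z hz => Or.inr hz⟩

/-- A definable predicate that holds on a dense set is generic, provided definable predicates are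
generically locally constant. -/
lemma eventually_generic_of_dense {p : X → Prop}
    (hloc : ∀ᶠ x in generic X, (∀ᶠ z in 𝓝 x, p z) ∨ ∀ᶠ z in 𝓝 x, ¬ p z)
    (h : ∀ W : Set X, IsOpen W → W.Nonempty → ∃ x ∈ W, p x) : ∀ᶠ x in generic X, p x := by
  refine eventually_generic_iff.2 fun W hW hne => ?_
  obtain ⟨x, hx, hp | hp⟩ := exists_of_eventually_generic hloc hW hne
  · exact ⟨x, hx, hp⟩
  · obtain ⟨V, hV, hVo, hxV⟩ := eventually_nhds_iff.1 hp
    obtain ⟨z, hz, hpz⟩ := h (W ∩ V) (hW.inter hVo) ⟨x, hx, hxV⟩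
    exact absurd hpz (hV z hz.2)

lemma Tame.of_homeomorph (hX : Tame L M X) (e : X ≃ₜ Y) (he : DF L M e) : Tame L M Y := by
  have hloc : ∀ p : Y → Prop, DP L M p →
      ∀ᶠ x in generic Y, (∀ᶠ z in 𝓝 x, p z) ∨ ∀ᶠ z in 𝓝 x, ¬ p z := by
    intro p hp
    refine locConst_of_dense fun W hW hne => ?_
    obtain ⟨x, hx, h⟩ := exists_of_eventually_generic (hX.locConst (fun x => p (e x)) (hp.comp he))
      (hW.preimage e.continuous) (hne.preimage e.surjective)
    refine ⟨e x, hx, ?_⟩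
    simpa only [← e.map_nhds_eq, eventually_map] using h
  refine ⟨hloc, fun f hf => eventually_generic_iff.2 fun W hW hne => ?_⟩
  obtain ⟨x, hx, h⟩ := eventually_generic_iff.1 (hX.cont (fun x => f (e x)) (hf.comp he)) _
      (hW.preimage e.continuous) (hne.preimage e.surjective)
  refine ⟨e x, hx, ?_⟩
  rw [← e.map_nhds_eq, eventually_map]
  exact h.mono fun z hz => (e.comp_continuousAt_iff' f z).1 hz

variable (L M) in
lemma tame_fin_zero : Tame L M (Fin 0 → M) := by
  refine ⟨fun p _ => Eventually.of_forall fun x => ?_, fun f _ => Eventually.of_forall fun x => ?_⟩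
  · by_cases h : p x
    · exact Or.inl (Eventually.of_forall fun z => Subsingleton.elim x z ▸ h)
    · exact Or.inr (Eventually.of_forall fun z => Subsingleton.elim x z ▸ h)
  · have : f = fun _ => f x := funext fun z => by rw [Subsingleton.elim z x]
    rw [this]
    exact continuousAt_const

variable [OrderTopology M] [NoMinOrder M] [NoMaxOrder M]

lemma exists_prod_Ioo_subset {W : Set (X × M)} (hW : IsOpen W) (hne : W.Nonempty) :
    ∃ (U : Set X) (a b : M), IsOpen U ∧ U.Nonempty ∧ a < b ∧
      ∀ x ∈ U, ∀ y ∈ Ioo a b, (x, y) ∈ W := by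
  obtain ⟨⟨x, y⟩, hxy⟩ := hne
  obtain ⟨U, V, hU, hV, hx, hy, hUV⟩ := isOpen_prod_iff.1 hW x y hxy
  obtain ⟨a, b, hab, h⟩ := mem_nhds_iff_exists_Ioo_subset.1 (hV.mem_nhds hy)
  exact ⟨U, a, b, hU, ⟨x, hx⟩, hab.1.trans hab.2, fun x' hx' y' hy' => hUV ⟨hx', h hy'⟩⟩

variable [DenselyOrdered M]

/-- A function on `X × M` that is continuous in each variable near a point, and monotone or
antitone in the second variable, is continuous there. -/
lemma continuousAt_of_separately {h : X × M → M} {x : X} {y : M}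
    (hx : ∀ᶠ y' in 𝓝 y, ContinuousAt (fun x' => h (x', y')) x)
    (hy : ContinuousAt (fun y' => h (x, y')) y) {c d : M} (hcd : y ∈ Ioo c d)
    (hm : ∀ᶠ x' in 𝓝 x, MonotoneOn (fun y' => h (x', y')) (Ioo c d) ∨
      AntitoneOn (fun y' => h (x', y')) (Ioo c d)) : ContinuousAt h (x, y) := by
  have hI : ∀ᶠ y' in 𝓝 y, y' ∈ Ioo c d := Ioo_mem_nhds hcd.1 hcd.2
  have key : ∀ p : M → Prop, (∀ᶠ y' in 𝓝 y, p (h (x, y'))) →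
      (∀ y', p (h (x, y')) → ∀ᶠ v in 𝓝 (h (x, y')), p v) →
      ∃ y1 y2, y1 < y ∧ y < y2 ∧ y1 ∈ Ioo c d ∧ y2 ∈ Ioo c d ∧
        ∀ᶠ x' in 𝓝 x, p (h (x', y1)) ∧ p (h (x', y2)) := by
    intro p hp hp'
    have hall := hp.and (hx.and hI)
    obtain ⟨y1, ⟨h1, h1x, h1I⟩, hy1⟩ :=
      ((hall.filter_mono nhdsWithin_le_nhds).and (self_mem_nhdsWithin (s := Iio y))).exists
    obtain ⟨y2, ⟨h2, h2x, h2I⟩, hy2⟩ :=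
      ((hall.filter_mono nhdsWithin_le_nhds).and (self_mem_nhdsWithin (s := Ioi y))).exists
    exact ⟨y1, y2, hy1, hy2, h1I, h2I, (h1x.eventually (hp' y1 h1)).and (h2x.eventually (hp' y2 h2))⟩
  refine tendsto_order.2 ⟨fun u hu => ?_, fun u hu => ?_⟩
  · obtain ⟨y1, y2, hy1, hy2, hI1, hI2, hev⟩ := key (fun v => u < v) (hy.eventually (lt_mem_nhds hu))
      (fun _ h => lt_mem_nhds h)
    filter_upwards [(hev.and hm).prod_nhds (Ioo_mem_nhds hy1 hy2)] with q hq
    obtain ⟨⟨⟨h1, h2⟩, hm⟩, hq1, hq2⟩ := hq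
    have hqI : q.2 ∈ Ioo c d := ⟨hI1.1.trans hq1, hq2.trans hI2.2⟩
    rcases hm with hm | hm
    · exact h1.trans_le (hm hI1 hqI hq1.le)
    · exact h2.trans_le (hm hqI hI2 hq2.le)
  · obtain ⟨y1, y2, hy1, hy2, hI1, hI2, hev⟩ := key (fun v => v < u) (hy.eventually (gt_mem_nhds hu))
      (fun _ h => gt_mem_nhds h)
    filter_upwards [(hev.and hm).prod_nhds (Ioo_mem_nhds hy1 hy2)] with q hq
    obtain ⟨⟨⟨h1, h2⟩, hm⟩, hq1, hq2⟩ := hq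
    have hqI : q.2 ∈ Ioo c d := ⟨hI1.1.trans hq1, hq2.trans hI2.2⟩
    rcases hm with hm | hm
    · exact (hm hqI hI2 hq2.le).trans_lt h2
    · exact (hm hI1 hqI hq1.le).trans_lt h1

variable [OM L M] [Nonempty M]

lemma Tame.locConst_prod (hX : Tame L M X) {p : X × M → Prop} (hp : DP L M p) :
    ∀ᶠ x in generic (X × M), (∀ᶠ z in 𝓝 x, p z) ∨ ∀ᶠ z in 𝓝 x, ¬ p z := by
  refine locConst_of_dense fun W hW hne => ?_
  obtain ⟨U, a, b, hU, hUne, hab, hUW⟩ := exists_prod_Ioo_subset hW hne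
  -- On each fibre, choose an interval on which `p` is constant, with definable endpoints.
  have hS : DP L M (fun q : X × (M × M) => (a ≤ q.2.1 ∧ q.2.1 < q.2.2 ∧ q.2.2 ≤ b) ∧
      ((∀ y, y ∈ Ioo q.2.1 q.2.2 → p (q.1, y)) ∨ ∀ y, y ∈ Ioo q.2.1 q.2.2 → ¬ p (q.1, y))) := by
    refine DP.and ?_ (DP.or (DP.all (DP.imp ?_ ?_)) (DP.all (DP.imp ?_ ?_))) <;> fun_prop
  obtain ⟨f, hf, hfS⟩ := exists_df_choice (p := fun (x : X) (c : M × M) =>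
    (a ≤ c.1 ∧ c.1 < c.2 ∧ c.2 ≤ b) ∧
      ((∀ y, y ∈ Ioo c.1 c.2 → p (x, y)) ∨ ∀ y, y ∈ Ioo c.1 c.2 → ¬ p (x, y))) hS
  replace hfS := fun x => hfS x (by
    obtain ⟨a', b', h, hs, h'⟩ := exists_subinterval (L := L) (p := fun y => p (x, y))
      (by fun_prop) hab
    rw [Ioo_subset_Ioo_iff h] at hs
    exact ⟨(a', b'), ⟨hs.1, h, hs.2⟩, h'⟩)
  have hq : DP L M (fun x => ∀ y, y ∈ Ioo (f x).1 (f x).2 → p (x, y)) := by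
    refine DP.all (DP.imp ?_ ?_) <;> fun_prop
  obtain ⟨x, hx, ⟨hc1, hc2⟩, hloc⟩ := exists_of_eventually_generic
    (((hX.cont (fun x => (f x).1) (by fun_prop)).and
      (hX.cont (fun x => (f x).2) (by fun_prop))).and (hX.locConst _ hq)) hU hUne
  obtain ⟨y, hy⟩ := exists_between (hfS x).1.2.1
  refine ⟨(x, y), hUW x hx y ⟨(hfS x).1.1.trans_lt hy.1, hy.2.trans_le (hfS x).1.2.2⟩, ?_⟩
  have hfst : Tendsto Prod.fst (𝓝 (x, y)) (𝓝 x) := continuous_fst.tendsto _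
  have hsnd : Tendsto Prod.snd (𝓝 (x, y)) (𝓝 y) := continuous_snd.tendsto _
  have h1 : ∀ᶠ z in 𝓝 (x, y), (f z.1).1 < z.2 := (hc1.tendsto.comp hfst).eventually_lt hsnd hy.1
  have h2 : ∀ᶠ z in 𝓝 (x, y), z.2 < (f z.1).2 := hsnd.eventually_lt (hc2.tendsto.comp hfst) hy.2
  rcases hloc with hloc | hloc
  · left
    filter_upwards [h1, h2, hfst.eventually hloc] with z hz1 hz2 hz
    exact hz z.2 ⟨hz1, hz2⟩
  · right
    filter_upwards [h1, h2, hfst.eventually hloc] with z hz1 hz2 hz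
    exact (hfS z.1).2.resolve_left hz z.2 ⟨hz1, hz2⟩

lemma Tame.prod (hX : Tame L M X) : Tame L M (X × M) := by
  refine ⟨fun p hp => hX.locConst_prod hp, fun h hh => ?_⟩
  refine eventually_generic_of_dense (hX.locConst_prod (by fun_prop)) fun W hW hne => ?_
  obtain ⟨U, a, b, hU, hUne, hab, hUW⟩ := exists_prod_Ioo_subset hW hne
  -- On each fibre, choose an interval on which `h` is continuous and monotone or antitone.
  let S : X → M × M → Prop := fun x c => (a ≤ c.1 ∧ c.1 < c.2 ∧ c.2 ≤ b) ∧
    (∀ y, y ∈ Ioo c.1 c.2 → ContinuousAt (fun y => h (x, y)) y) ∧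
      ((∀ y y', y ∈ Ioo c.1 c.2 → y' ∈ Ioo c.1 c.2 → y ≤ y' → h (x, y) ≤ h (x, y')) ∨
        ∀ y y', y ∈ Ioo c.1 c.2 → y' ∈ Ioo c.1 c.2 → y ≤ y' → h (x, y') ≤ h (x, y))
  have hS : DP L M (fun q : X × (M × M) => S q.1 q.2) := by
    refine DP.and ?_ (DP.and (DP.all (DP.imp ?_ ?_))
      (DP.or (DP.all (DP.all (DP.imp ?_ (DP.imp ?_ (DP.imp ?_ ?_)))))
        (DP.all (DP.all (DP.imp ?_ (DP.imp ?_ (DP.imp ?_ ?_)))))))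
    · fun_prop
    · fun_prop
    · refine DP.continuousAt (P := (X × (M × M)) × M) (h := fun q y => h (q.1.1, y)) ?_ ?_ <;> fun_prop
    all_goals fun_prop
  obtain ⟨f, hf, hfS⟩ := exists_df_choice hS
  replace hfS := fun x => hfS x (by
    obtain ⟨a', b', h', hs, hc, hm⟩ := exists_subinterval_continuous_monotone (L := L)
      (f := fun y => h (x, y)) (by fun_prop) hab
    rw [Ioo_subset_Ioo_iff h'] at hs
    exact ⟨(a', b'), ⟨hs.1, h', hs.2⟩, hc,
      hm.imp (fun hm y y' hy hy' h => hm hy hy' h) (fun hm y y' hy hy' h => hm hy hy' h)⟩)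
  obtain ⟨x0, hx0, hc1, hc2⟩ := exists_of_eventually_generic
    ((hX.cont (fun x => (f x).1) (by fun_prop)).and
      (hX.cont (fun x => (f x).2) (by fun_prop))) hU hUne
  obtain ⟨c, hfc, hc⟩ := exists_between (hfS x0).1.2.1
  obtain ⟨d, hcd, hd⟩ := exists_between hc
  obtain ⟨V, hV, hVo, hxV⟩ := eventually_nhds_iff.1 ((hc1.eventually (gt_mem_nhds hfc)).and
    (hc2.eventually (lt_mem_nhds hd)))
  -- At points of a smaller box `h` is also continuous in the first variable.
  have hdp : DP L M (fun q : X × M => ContinuousAt (fun x => h (x, q.2)) q.1) := by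
    refine DP.continuousAt (P := X × M) (h := fun q x => h (x, q.2)) ?_ ?_ <;> fun_prop
  obtain ⟨⟨x1, y1⟩, ⟨hx1, hy1⟩, hloc⟩ := exists_of_eventually_generic (hX.locConst_prod hdp)
    ((hU.inter hVo).prod (isOpen_Ioo (a := c) (b := d)))
    ((show (U ∩ V).Nonempty from ⟨x0, hx0, hxV⟩).prod (nonempty_Ioo.2 hcd))
  have hIoo : ∀ x ∈ V, ∀ y ∈ Ioo c d, y ∈ Ioo (f x).1 (f x).2 := fun x hx y hy =>
    ⟨(hV x hx).1.trans hy.1, hy.2.trans (hV x hx).2⟩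
  refine ⟨(x1, y1), hUW x1 hx1.1 y1 ?_, ?_⟩
  · have := hIoo x1 hx1.2 y1 hy1
    exact ⟨(hfS x1).1.1.trans_lt this.1, this.2.trans_le (hfS x1).1.2.2⟩
  have hcont : ∀ᶠ q in 𝓝 (x1, y1), ContinuousAt (fun x => h (x, q.2)) q.1 := by
    refine hloc.resolve_right fun hnot => ?_
    obtain ⟨N, hN, hNo, hxN⟩ := eventually_nhds_iff.1 hnot
    have hNo' : IsOpen {x | (x, y1) ∈ N} := hNo.preimage (by fun_prop)
    obtain ⟨x, hxN, hx⟩ := exists_of_eventually_generic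
      (hX.cont (fun x => h (x, y1)) (by fun_prop)) hNo' ⟨x1, hxN⟩
    exact hN (x, y1) hxN hx
  refine continuousAt_of_separately (c := c) (d := d) ?_ ?_ hy1 ?_
  · have : Tendsto (fun y => (x1, y)) (𝓝 y1) (𝓝 (x1, y1)) := by
      exact (Continuous.tendsto (by fun_prop) _)
    exact this.eventually hcont
  · exact (hfS x1).2.1 y1 (hIoo x1 hx1.2 y1 hy1)
  · filter_upwards [hVo.mem_nhds hx1.2] with x hx
    exact (hfS x).2.2.imp
      (fun hm y hy y' hy' h => hm y y' (hIoo x hx y hy) (hIoo x hx y' hy') h)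
      (fun hm y hy y' hy' h => hm y y' (hIoo x hx y hy) (hIoo x hx y' hy') h)

end Tame

section Snoc

variable {L : Language} {M : Type*} [TopologicalSpace M] [L.Structure M]

/-- The identification of `M ^ k × M` with `M ^ (k + 1)`. -/
def snocHomeomorph (M : Type*) [TopologicalSpace M] (k : ℕ) :
    (Fin k → M) × M ≃ₜ (Fin (k + 1) → M) where
  toFun q := Fin.snoc (α := fun _ => M) q.1 q.2
  invFun x := (x ∘ Fin.castSucc, x (Fin.last k))
  left_inv q := by
    ext j
    · simp
    · simp
  right_inv x := by
    ext j
    refine Fin.lastCases ?_ (fun i => ?_) j <;> simp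
  continuous_toFun := by fun_prop
  continuous_invFun := by fun_prop

@[fun_prop]
lemma df_snoc (k : ℕ) : DF L M (fun q : (Fin k → M) × M => Fin.snoc (α := fun _ => M) q.1 q.2) := by
  refine DF.pi fun i => ?_
  refine Fin.lastCases ?_ (fun i => ?_) i
  · simp only [Fin.snoc_last]
    fun_prop
  · simp only [Fin.snoc_castSucc]
    fun_prop

variable [LinearOrder M] [OrderTopology M] [NoMinOrder M] [NoMaxOrder M] [DenselyOrdered M]
  [OM L M] [Nonempty M]

variable (L M) in
/-- Near a generic point of `M ^ k`, a definable predicate is constant and a definable function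
is continuous. -/
theorem tame_fin (k : ℕ) : Tame L M (Fin k → M) := by
  induction k with
  | zero => exact tame_fin_zero L M
  | succ k ih => exact ih.prod.of_homeomorph (snocHomeomorph M k) (df_snoc k)

end Snoc

/-! ### Open cells -/

section Cells

variable {L : Language} {M : Type*} [LinearOrder M] [TopologicalSpace M] [L.Structure M]

lemma isOpenCell_succ_iff {n : ℕ} {C : Set (Fin (n + 1) → M)} : IsOpenCell L C ↔
    ∃ (X : Set (Fin n → M)) (F G : (Fin n → M) → WithBot (WithTop M)), IsOpenCell L X ∧
      IsBound L X F ∧ IsBound L X G ∧ (∀ x ∈ X, F x < G x) ∧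
      C = {x : Fin (n + 1) → M | x ∘ Fin.castSucc ∈ X ∧
        F (x ∘ Fin.castSucc) < ((x (Fin.last n) : WithTop M) : WithBot (WithTop M)) ∧
        ((x (Fin.last n) : WithTop M) : WithBot (WithTop M)) < G (x ∘ Fin.castSucc)} := by
  constructor
  · rintro ⟨X, hX, ⟨h, -⟩ | ⟨-, F, G, hF, hG, hFG, rfl⟩⟩
    · exact absurd h (by simp)
    · exact ⟨X, F, G, hX, hF, hG, hFG, rfl⟩
  · rintro ⟨X, F, G, hX, hF, hG, hFG, rfl⟩
    exact ⟨X, hX, Or.inr ⟨rfl, F, G, hF, hG, hFG, rfl⟩⟩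

lemma snoc_comp_castSucc {n : ℕ} (x : Fin n → M) (y : M) :
    (Fin.snoc (α := fun _ => M) x y : Fin (n + 1) → M) ∘ Fin.castSucc = x := by
  ext i
  simp

lemma snoc_castSucc_last {n : ℕ} (x : Fin (n + 1) → M) :
    Fin.snoc (α := fun _ => M) (x ∘ Fin.castSucc) (x (Fin.last n)) = x := by
  ext j
  refine Fin.lastCases ?_ (fun i => ?_) j <;> simp

lemma continuous_snoc_left {n : ℕ} (y : M) :
    Continuous (fun x : Fin n → M => (Fin.snoc (α := fun _ => M) x y : Fin (n + 1) → M)) := by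
  fun_prop

lemma continuous_snoc_right {n : ℕ} (x : Fin n → M) :
    Continuous (fun y : M => (Fin.snoc (α := fun _ => M) x y : Fin (n + 1) → M)) := by
  fun_prop

variable [OrderTopology M] [NoMinOrder M] [NoMaxOrder M] [DenselyOrdered M] [OM L M] [Nonempty M]

/-- In the description of a bound on a cell, the function may be taken to be definable
everywhere. -/
lemma IsBound.cases {n : ℕ} {X : Set (Fin n → M)} {F : (Fin n → M) → WithBot (WithTop M)}
    (hF : IsBound L X F) :
    (∃ f : (Fin n → M) → M, ContinuousOn f X ∧ DF L M f ∧
      ∀ x ∈ X, F x = ((f x : WithTop M) : WithBot (WithTop M))) ∨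
    (∀ x ∈ X, F x = ⊥) ∨ (∀ x ∈ X, F x = ⊤) := by
  refine hF.imp_left ?_
  rintro ⟨f, hf, hfd, hFf⟩
  obtain ⟨g, hg, hgf⟩ := exists_df_of_defMap hfd
  have hgf' : ∀ x ∈ X, g x () = f x := fun x hx => congrFun (hgf x hx) ()
  exact ⟨fun x => g x (), hf.congr hgf', by fun_prop, fun x hx => by
    simp only [hFf x hx, hgf' x hx]⟩

lemma IsBound.some {n : ℕ} {X : Set (Fin n → M)} (hX : DP L M (fun x => x ∈ X))
    {f : (Fin n → M) → M} (hf : ContinuousOn f X) (hfd : DF L M f) :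
    IsBound L X (fun x => ((f x : WithTop M) : WithBot (WithTop M))) :=
  Or.inl ⟨f, hf, defFun_of_df hX hfd, fun _ _ => rfl⟩

section Bound

variable {n : ℕ} {X : Set (Fin n → M)} {F : (Fin n → M) → WithBot (WithTop M)}

lemma IsBound.dp_lt (hX : DP L M (fun x => x ∈ X)) (hF : IsBound L X F) :
    DP L M (fun q : (Fin n → M) × M =>
      q.1 ∈ X ∧ F q.1 < ((q.2 : WithTop M) : WithBot (WithTop M))) := by
  rcases hF.cases with ⟨f, -, hf, hFf⟩ | h | h
  · have : ∀ q : (Fin n → M) × M, (q.1 ∈ X ∧ F q.1 < ((q.2 : WithTop M) : WithBot (WithTop M))) ↔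
        (q.1 ∈ X ∧ f q.1 < q.2) := fun q => and_congr_right fun hq => by
      rw [hFf _ hq, WithBot.coe_lt_coe, WithTop.coe_lt_coe]
    simp only [this]
    fun_prop
  · have : ∀ q : (Fin n → M) × M, (q.1 ∈ X ∧ F q.1 < ((q.2 : WithTop M) : WithBot (WithTop M))) ↔
        q.1 ∈ X := fun q => and_iff_left_of_imp fun hq => by
      rw [h _ hq]
      exact WithBot.bot_lt_coe _
    simp only [this]
    fun_prop
  · have : ∀ q : (Fin n → M) × M, (q.1 ∈ X ∧ F q.1 < ((q.2 : WithTop M) : WithBot (WithTop M))) ↔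
        False := fun q => iff_false_intro fun hq => by
      have := hq.2
      rw [h _ hq.1] at this
      exact not_top_lt this
    simp only [this]
    fun_prop

lemma IsBound.dp_gt (hX : DP L M (fun x => x ∈ X)) (hF : IsBound L X F) :
    DP L M (fun q : (Fin n → M) × M =>
      q.1 ∈ X ∧ ((q.2 : WithTop M) : WithBot (WithTop M)) < F q.1) := by
  rcases hF.cases with ⟨f, -, hf, hFf⟩ | h | h
  · have : ∀ q : (Fin n → M) × M, (q.1 ∈ X ∧ ((q.2 : WithTop M) : WithBot (WithTop M)) < F q.1) ↔
        (q.1 ∈ X ∧ q.2 < f q.1) := fun q => and_congr_right fun hq => by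
      rw [hFf _ hq, WithBot.coe_lt_coe, WithTop.coe_lt_coe]
    simp only [this]
    fun_prop
  · have : ∀ q : (Fin n → M) × M, (q.1 ∈ X ∧ ((q.2 : WithTop M) : WithBot (WithTop M)) < F q.1) ↔
        False := fun q => iff_false_intro fun hq => by
      have := hq.2
      rw [h _ hq.1] at this
      exact not_lt_bot this
    simp only [this]
    fun_prop
  · have : ∀ q : (Fin n → M) × M, (q.1 ∈ X ∧ ((q.2 : WithTop M) : WithBot (WithTop M)) < F q.1) ↔
        q.1 ∈ X := fun q => and_iff_left_of_imp fun hq => by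
      rw [h _ hq]
      exact WithBot.coe_lt_coe.2 (WithTop.coe_lt_top _)
    simp only [this]
    fun_prop

lemma IsBound.eventually_lt (hX : IsOpen X) (hF : IsBound L X F) {q : (Fin n → M) × M}
    (hq : q.1 ∈ X) (h : F q.1 < ((q.2 : WithTop M) : WithBot (WithTop M))) :
    ∀ᶠ z in 𝓝 q, F z.1 < ((z.2 : WithTop M) : WithBot (WithTop M)) := by
  have hfst : Tendsto Prod.fst (𝓝 q) (𝓝 q.1) := continuous_fst.tendsto _
  have hsnd : Tendsto Prod.snd (𝓝 q) (𝓝 q.2) := continuous_snd.tendsto _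
  have hev : ∀ᶠ z in 𝓝 q, z.1 ∈ X := hfst.eventually (hX.mem_nhds hq)
  rcases hF.cases with ⟨f, hfc, hf, hFf⟩ | h' | h'
  · rw [hFf _ hq, WithBot.coe_lt_coe, WithTop.coe_lt_coe] at h
    filter_upwards [hev, ((hfc.continuousAt (hX.mem_nhds hq)).tendsto.comp hfst).eventually_lt
      hsnd h] with z hz hz'
    rw [hFf _ hz, WithBot.coe_lt_coe, WithTop.coe_lt_coe]
    exact hz'
  · filter_upwards [hev] with z hz
    rw [h' _ hz]
    exact WithBot.bot_lt_coe _
  · rw [h' _ hq] at h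
    exact absurd h not_top_lt

lemma IsBound.eventually_gt (hX : IsOpen X) (hF : IsBound L X F) {q : (Fin n → M) × M}
    (hq : q.1 ∈ X) (h : ((q.2 : WithTop M) : WithBot (WithTop M)) < F q.1) :
    ∀ᶠ z in 𝓝 q, ((z.2 : WithTop M) : WithBot (WithTop M)) < F z.1 := by
  have hfst : Tendsto Prod.fst (𝓝 q) (𝓝 q.1) := continuous_fst.tendsto _
  have hsnd : Tendsto Prod.snd (𝓝 q) (𝓝 q.2) := continuous_snd.tendsto _
  have hev : ∀ᶠ z in 𝓝 q, z.1 ∈ X := hfst.eventually (hX.mem_nhds hq)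
  rcases hF.cases with ⟨f, hfc, hf, hFf⟩ | h' | h'
  · rw [hFf _ hq, WithBot.coe_lt_coe, WithTop.coe_lt_coe] at h
    filter_upwards [hev, hsnd.eventually_lt
      ((hfc.continuousAt (hX.mem_nhds hq)).tendsto.comp hfst) h] with z hz hz'
    rw [hFf _ hz, WithBot.coe_lt_coe, WithTop.coe_lt_coe]
    exact hz'
  · rw [h' _ hq] at h
    exact absurd h not_lt_bot
  · filter_upwards [hev] with z hz
    rw [h' _ hz]
    exact WithBot.coe_lt_coe.2 (WithTop.coe_lt_top _)

lemma IsBound.exists_between {G : (Fin n → M) → WithBot (WithTop M)} (hF : IsBound L X F)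
    (hG : IsBound L X G) {x : Fin n → M} (hx : x ∈ X) (h : F x < G x) :
    ∃ y : M, F x < ((y : WithTop M) : WithBot (WithTop M)) ∧
      ((y : WithTop M) : WithBot (WithTop M)) < G x := by
  rcases hF with ⟨f, -, -, hf⟩ | hf | hf <;> rcases hG with ⟨g, -, -, hg⟩ | hg | hg <;>
    rw [hf _ hx, hg _ hx] at *
  · simp only [WithBot.coe_lt_coe, WithTop.coe_lt_coe] at *
    exact _root_.exists_between h
  · exact absurd h not_lt_bot
  · obtain ⟨y, hy⟩ := exists_gt (f x)
    exact ⟨y, by simpa using hy, WithBot.coe_lt_coe.2 (WithTop.coe_lt_top _)⟩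
  · obtain ⟨y, hy⟩ := exists_lt (g x)
    exact ⟨y, WithBot.bot_lt_coe _, by simpa using hy⟩
  · exact absurd h not_lt_bot
  · exact ⟨Classical.arbitrary M, WithBot.bot_lt_coe _, WithBot.coe_lt_coe.2 (WithTop.coe_lt_top _)⟩
  all_goals exact absurd h not_top_lt

end Bound

lemma IsOpenCell.dp {n : ℕ} {C : Set (Fin n → M)} (hC : IsOpenCell L C) :
    DP L M (fun x => x ∈ C) := by
  induction n with
  | zero =>
    rw [show C = univ from hC]
    exact DP.const True
  | succ n ih =>
    obtain ⟨X, F, G, hX, hF, hG, -, rfl⟩ := isOpenCell_succ_iff.1 hC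
    have h := ((hF.dp_lt (ih hX)).and (hG.dp_gt (ih hX))).comp
      (f := fun x : Fin (n + 1) → M => (x ∘ Fin.castSucc, x (Fin.last n)))
      (DF.prodMk (df_reindex _) (by fun_prop))
    have heq : ∀ x : Fin (n + 1) → M, (x ∘ Fin.castSucc ∈ X ∧
        F (x ∘ Fin.castSucc) < ((x (Fin.last n) : WithTop M) : WithBot (WithTop M)) ∧
        ((x (Fin.last n) : WithTop M) : WithBot (WithTop M)) < G (x ∘ Fin.castSucc)) ↔
        ((x ∘ Fin.castSucc ∈ X ∧
          F (x ∘ Fin.castSucc) < ((x (Fin.last n) : WithTop M) : WithBot (WithTop M))) ∧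
          x ∘ Fin.castSucc ∈ X ∧
          ((x (Fin.last n) : WithTop M) : WithBot (WithTop M)) < G (x ∘ Fin.castSucc)) := by
      intro x
      tauto
    simp only [mem_ofPred_eq, heq]
    exact h

lemma IsOpenCell.isOpen {n : ℕ} {C : Set (Fin n → M)} (hC : IsOpenCell L C) : IsOpen C := by
  induction n with
  | zero =>
    rw [show C = univ from hC]
    exact isOpen_univ
  | succ n ih =>
    obtain ⟨X, F, G, hX, hF, hG, -, rfl⟩ := isOpenCell_succ_iff.1 hC
    rw [isOpen_iff_mem_nhds]
    rintro x ⟨hx, h1, h2⟩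
    have ht : Tendsto (fun x : Fin (n + 1) → M => (x ∘ Fin.castSucc, x (Fin.last n))) (𝓝 x)
        (𝓝 (x ∘ Fin.castSucc, x (Fin.last n))) := (snocHomeomorph M n).symm.continuous.tendsto x
    filter_upwards [ht.eventually (hF.eventually_lt (ih hX) hx h1),
      ht.eventually (hG.eventually_gt (ih hX) hx h2),
      ((continuous_fst.tendsto _).comp ht).eventually ((ih hX).mem_nhds hx)] with z h1 h2 h3
    exact ⟨h3, h1, h2⟩

lemma IsOpenCell.nonempty {n : ℕ} {C : Set (Fin n → M)} (hC : IsOpenCell L C) : C.Nonempty := by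
  induction n with
  | zero =>
    rw [show C = univ from hC]
    exact univ_nonempty
  | succ n ih =>
    obtain ⟨X, F, G, hX, hF, hG, hFG, rfl⟩ := isOpenCell_succ_iff.1 hC
    obtain ⟨x, hx⟩ := ih hX
    obtain ⟨y, hy⟩ := hF.exists_between hG hx (hFG x hx)
    exact ⟨Fin.snoc (α := fun _ => M) x y, by
      simpa only [mem_ofPred_eq, snoc_comp_castSucc, Fin.snoc_last] using ⟨hx, hy⟩⟩

/-! ### Definable connectedness of open cells -/

lemma of_locConst_Icc {p : M → Prop} (hp : DP L M p) {x y : M} (hxy : x ≤ y)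
    (hloc : ∀ z ∈ Icc x y, (∀ᶠ w in 𝓝 z, p w) ∨ ∀ᶠ w in 𝓝 z, ¬ p w) (hx : p x) : p y := by
  by_contra hy
  have hZ : DP L M (fun z => x ≤ z ∧ z ≤ y ∧ ¬ p z) := by fun_prop
  obtain ⟨g, hg⟩ := exists_isGLB hZ ⟨y, hxy, le_rfl, hy⟩ ⟨x, fun z hz => hz.1⟩
  have hxg : x ≤ g := hg.2 fun z hz => hz.1
  have hgy : g ≤ y := hg.1 ⟨hxy, le_rfl, hy⟩
  rcases hloc g ⟨hxg, hgy⟩ with h | h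
  · obtain ⟨u, w, hgI, h⟩ := mem_nhds_iff_exists_Ioo_subset.1 h
    obtain ⟨z, hz, hgz, hzw⟩ := hg.exists_between hgI.2
    exact hz.2.2 (h ⟨hgI.1.trans_le hgz, hzw⟩)
  · have hne : x ≠ g := fun hxg => h.self_of_nhds (hxg ▸ hx)
    obtain ⟨z, hz, hzg⟩ := ((h.filter_mono nhdsWithin_le_nhds).and
      (Ioo_mem_nhdsLT (lt_of_le_of_ne hxg hne))).exists
    exact absurd (hg.1 ⟨hzg.1.le, hzg.2.le.trans hgy, hz⟩) (not_le.2 hzg.2)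

/-- A definable predicate that is locally constant on an order-convex set is constant on it. -/
lemma iff_of_locConst_ordConnected {p : M → Prop} (hp : DP L M p) {I : Set M}
    (hI : I.OrdConnected) (hloc : ∀ z ∈ I, (∀ᶠ w in 𝓝 z, p w) ∨ ∀ᶠ w in 𝓝 z, ¬ p w) {x y : M}
    (hx : x ∈ I) (hy : y ∈ I) : p x ↔ p y := by
  wlog hxy : x ≤ y generalizing x y
  · exact (this hy hx (le_of_not_ge hxy)).symm
  have hloc' : ∀ z ∈ Icc x y, (∀ᶠ w in 𝓝 z, p w) ∨ ∀ᶠ w in 𝓝 z, ¬ p w :=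
    fun z hz => hloc z (hI.out hx hy hz)
  refine ⟨of_locConst_Icc hp hxy hloc', fun h => by_contra fun h' => ?_⟩
  exact of_locConst_Icc hp.not hxy (fun z hz => (hloc' z hz).symm.imp_right (by simp)) h' h

/-- Open cells are definably connected: a definable predicate that is locally constant on an open
cell is constant on it. -/
theorem IsOpenCell.iff_of_locConst {n : ℕ} {C : Set (Fin n → M)} (hC : IsOpenCell L C)
    {p : (Fin n → M) → Prop} (hp : DP L M p)
    (hloc : ∀ z ∈ C, (∀ᶠ w in 𝓝 z, p w) ∨ ∀ᶠ w in 𝓝 z, ¬ p w) {x y : Fin n → M} (hx : x ∈ C)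
    (hy : y ∈ C) : p x ↔ p y := by
  induction n with
  | zero => rw [Subsingleton.elim x y]
  | succ n ih =>
    have hCo := hC.isOpen
    have hCd := hC.dp
    obtain ⟨X, F, G, hX, hF, hG, hFG, hCX⟩ := isOpenCell_succ_iff.1 hC
    have hmem : ∀ x y, (Fin.snoc (α := fun _ => M) x y : Fin (n + 1) → M) ∈ C ↔ x ∈ X ∧
        F x < ((y : WithTop M) : WithBot (WithTop M)) ∧
        ((y : WithTop M) : WithBot (WithTop M)) < G x := by
      intro x y
      simp only [hCX, mem_ofPred_eq, snoc_comp_castSucc, Fin.snoc_last]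
    have hfib : ∀ x y y', (Fin.snoc (α := fun _ => M) x y : Fin (n + 1) → M) ∈ C →
        (Fin.snoc (α := fun _ => M) x y' : Fin (n + 1) → M) ∈ C →
        (p (Fin.snoc (α := fun _ => M) x y) ↔ p (Fin.snoc (α := fun _ => M) x y')) := by
      intro x y y' hy hy'
      refine iff_of_locConst_ordConnected (L := L)
        (p := fun y => p (Fin.snoc (α := fun _ => M) x y))
        (I := {y | (Fin.snoc (α := fun _ => M) x y : Fin (n + 1) → M) ∈ C}) ?_ ⟨?_⟩ ?_ hy hy'
      · exact hp.comp ((df_snoc n).comp (f := fun q : (Fin n → M) × M => _) (g := fun y => (x, y))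
          (by fun_prop))
      · intro y hy y' hy' z hz
        simp only [mem_ofPred_eq, hmem] at hy hy' ⊢
        refine ⟨hy.1, hy.2.1.trans_le ?_, lt_of_le_of_lt ?_ hy'.2.2⟩
        · simpa using hz.1
        · simpa using hz.2
      · intro z hz
        exact (hloc _ hz).imp (fun h => (continuous_snoc_right x).continuousAt.eventually h)
          (fun h => (continuous_snoc_right x).continuousAt.eventually h)
    let q : (Fin n → M) → Prop := fun x =>
      ∃ y, (Fin.snoc (α := fun _ => M) x y : Fin (n + 1) → M) ∈ C ∧ p (Fin.snoc (α := fun _ => M) x y)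
    have hq : DP L M q := by
      refine DP.ex (DP.and (hCd.comp ?_) (hp.comp ?_)) <;> fun_prop
    have hpq : ∀ x y, (Fin.snoc (α := fun _ => M) x y : Fin (n + 1) → M) ∈ C →
        (q x ↔ p (Fin.snoc (α := fun _ => M) x y)) := fun x y hy =>
      ⟨fun ⟨y', hy', h⟩ => (hfib x y y' hy hy').2 h, fun h => ⟨y, hy, h⟩⟩
    have hqloc : ∀ z ∈ X, (∀ᶠ w in 𝓝 z, q w) ∨ ∀ᶠ w in 𝓝 z, ¬ q w := by
      intro z hz
      obtain ⟨y, hy⟩ := hF.exists_between hG hz (hFG z hz)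
      have hzy := (hmem z y).2 ⟨hz, hy⟩
      have ht := (continuous_snoc_left (n := n) y).continuousAt (x := z)
      have hC' := ht.eventually (hCo.mem_nhds hzy)
      refine (hloc _ hzy).imp (fun h => ?_) (fun h => ?_) <;>
      · filter_upwards [hC', ht.eventually h] with w hw hw'
        rwa [hpq w y hw]
    rw [← snoc_castSucc_last x] at hx ⊢
    rw [← snoc_castSucc_last y] at hy ⊢
    rw [← hpq _ _ hx, ← hpq _ _ hy]
    exact ih hX hq hqloc ((hmem _ _).1 hx).1 ((hmem _ _).1 hy).1

end Cells

/-! ### Finite unions -/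

section FinUnion

variable {α β : Type*}

/-- The set `X` is a finite union of sets satisfying `P`. -/
def FinUnion (P : Set α → Prop) (X : Set α) : Prop :=
  ∃ 𝒞 : Set (Set α), 𝒞.Finite ∧ (∀ C ∈ 𝒞, P C) ∧ ⋃₀ 𝒞 = X

variable {P Q : Set α → Prop}

lemma FinUnion.of_mem {X : Set α} (h : P X) : FinUnion P X :=
  ⟨{X}, finite_singleton X, by simpa using h, sUnion_singleton X⟩

lemma FinUnion.biUnion {ι : Type*} {s : Set ι} (hs : s.Finite) {X : ι → Set α}
    (h : ∀ i ∈ s, FinUnion P (X i)) : FinUnion P (⋃ i ∈ s, X i) := by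
  choose! 𝒞 h1 h2 h3 using h
  refine ⟨⋃ i ∈ s, 𝒞 i, hs.biUnion h1, ?_, ?_⟩
  · simp only [mem_iUnion]
    rintro C ⟨i, hi, hC⟩
    exact h2 i hi C hC
  · simp only [sUnion_iUnion]
    exact iUnion₂_congr h3

lemma FinUnion.union {X Y : Set α} (hX : FinUnion P X) (hY : FinUnion P Y) :
    FinUnion P (X ∪ Y) := by
  obtain ⟨𝒞, h1, h2, rfl⟩ := hX
  obtain ⟨𝒟, h1', h2', rfl⟩ := hY
  exact ⟨𝒞 ∪ 𝒟, h1.union h1', fun C hC => hC.elim (h2 C) (h2' C), sUnion_union _ _⟩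

/-- Transport of a finite union through an operation `T` on sets that commutes with unions. -/
lemma FinUnion.map {R : Set β → Prop} {X : Set α} (hX : FinUnion P X) (T : α → Set β)
    (h : ∀ C, P C → C ⊆ X → FinUnion R (⋃ x ∈ C, T x)) : FinUnion R (⋃ x ∈ X, T x) := by
  obtain ⟨𝒞, h1, h2, rfl⟩ := hX
  have := FinUnion.biUnion h1 (X := fun C => ⋃ x ∈ C, T x)
    fun C hC => h C (h2 C hC) (subset_sUnion_of_mem hC)
  convert this using 1
  ext y
  simp only [mem_iUnion, mem_sUnion]
  constructor
  · rintro ⟨x, ⟨C, hC, hx⟩, hy⟩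
    exact ⟨C, hC, x, hx, hy⟩
  · rintro ⟨C, hC, x, hx, hy⟩
    exact ⟨x, ⟨C, hC, hx⟩, hy⟩

lemma FinUnion.bind {X : Set α} (hX : FinUnion P X) (h : ∀ C, P C → C ⊆ X → FinUnion Q C) :
    FinUnion Q X := by
  have := hX.map (fun x => {x}) (R := Q) fun C hC hCX => by simpa using h C hC hCX
  simpa using this

end FinUnion

section Decomposition

variable {L : Language} {M : Type*} [LinearOrder M] [TopologicalSpace M] [L.Structure M]

/-! ### The statements of decomposition and of uniform finiteness -/

variable (L) in
/-- A definable set on which the projection forgetting some coordinate is injective. There are none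
in `M ^ 0`. -/
def Thin {k : ℕ} (E : Set (Fin k → M)) : Prop :=
  DP L M (fun x => x ∈ E) ∧ ∃ i, ∀ x ∈ E, ∀ y ∈ E, (∀ j, j ≠ i → x j = y j) → x = y

variable (L M) in
/-- Every definable subset of `M ^ k` is a finite union of open cells and thin sets. -/
def Decomposable (k : ℕ) : Prop :=
  ∀ X : Set (Fin k → M), DP L M (fun x => x ∈ X) → FinUnion (fun C => IsOpenCell L C ∨ Thin L C) X

/-- The fibres `{y | A x y}` for `x ∈ S` are covered by the values of finitely many definable
functions. -/
def CoveredOn (L : Language) [L.Structure M] {k : ℕ} (A : (Fin k → M) → M → Prop)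
    (S : Set (Fin k → M)) : Prop :=
  ∃ F : Set ((Fin k → M) → M), F.Finite ∧ (∀ f ∈ F, DF L M f) ∧
    ∀ x ∈ S, ∀ y, A x y → ∃ f ∈ F, f x = y

variable (L M) in
/-- Uniform finiteness: a definable family of finite subsets of `M` parametrized by `M ^ k` is
covered by finitely many definable functions. -/
def UniformlyFinite (k : ℕ) : Prop :=
  ∀ A : (Fin k → M) → M → Prop, DP L M (fun q : (Fin k → M) × M => A q.1 q.2) →
    (∀ x, {y | A x y}.Finite) → CoveredOn L A univ

variable [OrderTopology M] [NoMinOrder M] [NoMaxOrder M] [DenselyOrdered M] [OM L M] [Nonempty M]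

/-! ### Uniform finiteness -/

variable {k : ℕ} {A : (Fin k → M) → M → Prop}

lemma CoveredOn.sUnion {𝒮 : Set (Set (Fin k → M))} (h𝒮 : 𝒮.Finite)
    (h : ∀ S ∈ 𝒮, CoveredOn L A S) : CoveredOn L A (⋃₀ 𝒮) := by
  choose! F h1 h2 h3 using h
  refine ⟨⋃ S ∈ 𝒮, F S, h𝒮.biUnion h1, ?_, ?_⟩
  · simp only [mem_iUnion]
    rintro f ⟨S, hS, hf⟩
    exact h2 S hS f hf
  · rintro x ⟨S, hS, hx⟩ y hxy
    obtain ⟨f, hf, hfx⟩ := h3 S hS x hx y hxy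
    exact ⟨f, mem_biUnion hS hf, hfx⟩

/-- Fibres of bounded size are covered by finitely many choice functions. -/
lemma CoveredOn.of_ncard_le {S : Set (Fin k → M)} (N : ℕ)
    (hA : DP L M (fun q : (Fin k → M) × M => A q.1 q.2)) (hfin : ∀ x, {y | A x y}.Finite)
    (hN : ∀ x ∈ S, {y | A x y}.ncard ≤ N) : CoveredOn L A S := by
  induction N generalizing A with
  | zero =>
    refine ⟨∅, finite_empty, by simp, fun x hx y hxy => ?_⟩
    have := (ncard_eq_zero (hfin x)).1 (Nat.le_zero.1 (hN x hx))
    exact absurd (show y ∈ {y | A x y} from hxy) (this ▸ notMem_empty y)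
  | succ N ih =>
    obtain ⟨g, hg, hgA⟩ := exists_df_choice hA
    obtain ⟨F, h1, h2, h3⟩ := ih (A := fun x y => A x y ∧ ¬ y = g x) (by fun_prop)
      (fun x => (hfin x).subset fun y hy => hy.1) (fun x hx => by
        by_cases hne : ∃ y, A x y
        · have hlt : {y | A x y ∧ ¬ y = g x}.ncard < {y | A x y}.ncard := by
            refine ncard_lt_ncard ⟨fun y hy => hy.1, fun h => ?_⟩ (hfin x)
            exact (h (hgA x hne)).2 rfl
          have := hN x hx
          omega
        · have : {y | A x y ∧ ¬ y = g x} = ∅ := by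
            ext y
            simpa using fun h => absurd ⟨y, h⟩ hne
          rw [this, ncard_empty]
          exact Nat.zero_le _)
    refine ⟨insert g F, h1.insert g, ?_, fun x hx y hxy => ?_⟩
    · rintro f (rfl | hf)
      · exact hg
      · exact h2 f hf
    · by_cases hy : y = g x
      · exact ⟨g, mem_insert _ _, hy.symm⟩
      · obtain ⟨f, hf, hfx⟩ := h3 x hx y ⟨hxy, hy⟩
        exact ⟨f, mem_insert_of_mem _ hf, hfx⟩

lemma le_ncard_iff_exists_injective {α : Type*} {s : Set α} (hs : s.Finite) (n : ℕ) :
    n ≤ s.ncard ↔ ∃ v : Fin n → α, (∀ i j, i ≠ j → v i ≠ v j) ∧ ∀ i, v i ∈ s := by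
  constructor
  · intro h
    have := hs.to_subtype
    have := Fintype.ofFinite s
    rw [← Nat.card_coe_set_eq, Nat.card_eq_fintype_card] at h
    obtain ⟨e⟩ := Function.Embedding.nonempty_of_card_le (α := Fin n) (β := s) (by simpa using h)
    exact ⟨fun i => e i, fun i j hij h => hij (e.injective (Subtype.ext h)), fun i => (e i).2⟩
  · rintro ⟨v, hv, hvs⟩
    have hinj : Function.Injective v := fun i j h => by_contra fun hij => hv i j hij h
    have h1 : (range v).ncard = n := by
      rw [← Nat.card_coe_set_eq, Nat.card_range_of_injective hinj, Nat.card_fin]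
    rw [← h1]
    exact ncard_le_ncard (range_subset_iff.2 hvs) hs

lemma DP.ncard_eq {X : Type*} [TopologicalSpace X] [DefSpace M X] {B : X → M → Prop}
    (hB : DP L M (fun q : X × M => B q.1 q.2)) (hfin : ∀ x, {y | B x y}.Finite) (n : ℕ) :
    DP L M (fun x => {y | B x y}.ncard = n) := by
  have hle : ∀ n : ℕ, DP L M (fun x => n ≤ {y | B x y}.ncard) := by
    intro n
    simp only [fun x => le_ncard_iff_exists_injective (hfin x) n, mem_ofPred_eq]
    refine DP.ex (DP.and (DP.all_fin fun i => DP.all_fin fun j => DP.imp ?_ ?_)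
      (DP.all_fin fun i => ?_)) <;> fun_prop
  have : ∀ x, {y | B x y}.ncard = n ↔ n ≤ {y | B x y}.ncard ∧ ¬ n + 1 ≤ {y | B x y}.ncard := by
    intro x
    omega
  simp only [this]
  exact (hle n).and (hle (n + 1)).not

/-- Near `x`, the fibres of `A` are contained in a fixed interval. -/
def LocBounded (A : (Fin k → M) → M → Prop) (x : Fin k → M) : Prop :=
  ∃ c d, ∀ᶠ z in 𝓝 x, ∀ y, A z y → c < y ∧ y < d

/-- The set `A` is locally trivial at `(x, b)`: if the point belongs to `A`, then near it `A` is
the graph of a function that is continuous at `x`; otherwise it is away from `A`. -/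
def Normal (A : (Fin k → M) → M → Prop) (x : Fin k → M) (b : M) : Prop :=
  (A x b →
    (∃ c d, c < b ∧ b < d ∧ ∀ᶠ z in 𝓝 x, ∀ y y', y ∈ Ioo c d → y' ∈ Ioo c d →
      A z y → A z y' → y = y') ∧
    ∀ c d, c < b → b < d → ∀ᶠ z in 𝓝 x, ∃ y, y ∈ Ioo c d ∧ A z y) ∧
  (¬ A x b → ∃ c d, c < b ∧ b < d ∧ ∀ᶠ z in 𝓝 x, ∀ y, y ∈ Ioo c d → ¬ A z y)

lemma dp_locBounded (hA : DP L M (fun q : (Fin k → M) × M => A q.1 q.2)) :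
    DP L M (fun x => LocBounded A x) := by
  unfold LocBounded
  refine DP.ex (DP.ex (DP.eventually_nhds (DP.all (DP.imp ?_ ?_)) ?_)) <;> fun_prop

lemma dp_normal (hA : DP L M (fun q : (Fin k → M) × M => A q.1 q.2)) :
    DP L M (fun q : (Fin k → M) × M => Normal A q.1 q.2) := by
  unfold Normal
  refine DP.and (DP.imp ?_ (DP.and (DP.ex (DP.ex (DP.and ?_ (DP.and ?_
    (DP.eventually_nhds (DP.all (DP.all (DP.imp ?_ (DP.imp ?_ (DP.imp ?_ (DP.imp ?_ ?_)))))) ?_)))))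
      (DP.all (DP.all (DP.imp ?_ (DP.imp ?_ ?_))))))
    (DP.imp ?_ (DP.ex (DP.ex (DP.and ?_ (DP.and ?_
      (DP.eventually_nhds (DP.all (DP.imp ?_ ?_)) ?_)))))) <;> fun_prop

lemma eventually_generic_locBounded (hA : DP L M (fun q : (Fin k → M) × M => A q.1 q.2))
    (hfin : ∀ x, {y | A x y}.Finite) : ∀ᶠ x in generic (Fin k → M), LocBounded A x := by
  have hT := tame_fin L M k
  have hmin : DP L M (fun q : (Fin k → M) × M => A q.1 q.2 ∧ ∀ y, A q.1 y → q.2 ≤ y) := by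
    refine DP.and ?_ (DP.all (DP.imp ?_ ?_)) <;> fun_prop
  have hmax : DP L M (fun q : (Fin k → M) × M => A q.1 q.2 ∧ ∀ y, A q.1 y → y ≤ q.2) := by
    refine DP.and ?_ (DP.all (DP.imp ?_ ?_)) <;> fun_prop
  obtain ⟨m, hm, hmA⟩ := exists_df_choice (p := fun x y => A x y ∧ ∀ y', A x y' → y ≤ y') hmin
  obtain ⟨m', hm', hmA'⟩ := exists_df_choice (p := fun x y => A x y ∧ ∀ y', A x y' → y' ≤ y) hmax
  refine eventually_generic_of_dense (hT.locConst _ (dp_locBounded hA)) fun W hW hne => ?_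
  obtain ⟨x, hx, ⟨hc, hc'⟩, hloc⟩ := exists_of_eventually_generic
    (((hT.cont m hm).and (hT.cont m' hm')).and (hT.locConst (fun x => ∃ y, A x y) (by fun_prop)))
    hW hne
  refine ⟨x, hx, ?_⟩
  obtain ⟨c, hcm⟩ := exists_lt (m x)
  obtain ⟨d, hmd⟩ := exists_gt (m' x)
  rcases hloc with hloc | hloc
  · refine ⟨c, d, ?_⟩
    filter_upwards [hloc, hc.eventually (lt_mem_nhds hcm), hc'.eventually (gt_mem_nhds hmd)]
      with z hz h1 h2 y hy
    obtain ⟨y1, hy1, hmin⟩ := Set.exists_min_image _ id (hfin z) hz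
    obtain ⟨y2, hy2, hmax⟩ := Set.exists_max_image _ id (hfin z) hz
    exact ⟨h1.trans_le ((hmA z ⟨y1, hy1, hmin⟩).2 y hy),
      ((hmA' z ⟨y2, hy2, hmax⟩).2 y hy).trans_lt h2⟩
  · exact ⟨c, d, hloc.mono fun z hz y hy => absurd ⟨y, hy⟩ hz⟩

/-- Below a definable function, there is generically a gap in the fibres of `A`. -/
lemma eventually_generic_gap_below (hA : DP L M (fun q : (Fin k → M) × M => A q.1 q.2))
    (hfin : ∀ x, {y | A x y}.Finite) {β : (Fin k → M) → M} (hβ : DF L M β) :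
    ∀ᶠ x in generic (Fin k → M), ∃ c, c < β x ∧ ∀ᶠ z in 𝓝 x, ∀ y, A z y → c < y → β z ≤ y := by
  have hT := tame_fin L M k
  have hmax : DP L M (fun q : (Fin k → M) × M =>
      (A q.1 q.2 ∧ q.2 < β q.1) ∧ ∀ y, A q.1 y → y < β q.1 → y ≤ q.2) := by
    refine DP.and ?_ (DP.all (DP.imp ?_ (DP.imp ?_ ?_))) <;> fun_prop
  obtain ⟨m, hm, hmA⟩ := exists_df_choice
    (p := fun x y => (A x y ∧ y < β x) ∧ ∀ y', A x y' → y' < β x → y' ≤ y) hmax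
  filter_upwards [hT.cont m hm, hT.locConst (fun x => ∃ y, A x y ∧ y < β x) (by fun_prop)]
    with x hc hloc
  rcases hloc with hloc | hloc
  · have hmA' : ∀ z, (∃ y, A z y ∧ y < β z) →
        (A z (m z) ∧ m z < β z) ∧ ∀ y', A z y' → y' < β z → y' ≤ m z := by
      intro z hz
      obtain ⟨y, hy, hmax⟩ := Set.exists_max_image {y | A z y ∧ y < β z} id
        ((hfin z).subset fun y hy => hy.1) hz
      exact hmA z ⟨y, hy, fun y' h h' => hmax y' ⟨h, h'⟩⟩
    obtain ⟨c, hmc, hcβ⟩ := exists_between (hmA' x hloc.self_of_nhds).1.2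
    refine ⟨c, hcβ, ?_⟩
    filter_upwards [hloc, hc.eventually (gt_mem_nhds hmc)] with z hz hzc y hy hcy
    by_contra hlt
    exact absurd ((hmA' z hz).2 y hy (not_le.1 hlt)) (not_le.2 (hzc.trans hcy))
  · obtain ⟨c, hc⟩ := exists_lt (β x)
    exact ⟨c, hc, hloc.mono fun z hz y hy _ => not_lt.1 fun h => hz ⟨y, hy, h⟩⟩

/-- Above a definable function, there is generically a gap in the fibres of `A`. -/
lemma eventually_generic_gap_above (hA : DP L M (fun q : (Fin k → M) × M => A q.1 q.2))
    (hfin : ∀ x, {y | A x y}.Finite) {β : (Fin k → M) → M} (hβ : DF L M β) :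
    ∀ᶠ x in generic (Fin k → M), ∃ d, β x < d ∧ ∀ᶠ z in 𝓝 x, ∀ y, A z y → y < d → y ≤ β z := by
  have hT := tame_fin L M k
  have hmin : DP L M (fun q : (Fin k → M) × M =>
      (A q.1 q.2 ∧ β q.1 < q.2) ∧ ∀ y, A q.1 y → β q.1 < y → q.2 ≤ y) := by
    refine DP.and ?_ (DP.all (DP.imp ?_ (DP.imp ?_ ?_))) <;> fun_prop
  obtain ⟨m, hm, hmA⟩ := exists_df_choice
    (p := fun x y => (A x y ∧ β x < y) ∧ ∀ y', A x y' → β x < y' → y ≤ y') hmin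
  filter_upwards [hT.cont m hm, hT.locConst (fun x => ∃ y, A x y ∧ β x < y) (by fun_prop)]
    with x hc hloc
  rcases hloc with hloc | hloc
  · have hmA' : ∀ z, (∃ y, A z y ∧ β z < y) →
        (A z (m z) ∧ β z < m z) ∧ ∀ y', A z y' → β z < y' → m z ≤ y' := by
      intro z hz
      obtain ⟨y, hy, hmin⟩ := Set.exists_min_image {y | A z y ∧ β z < y} id
        ((hfin z).subset fun y hy => hy.1) hz
      exact hmA z ⟨y, hy, fun y' h h' => hmin y' ⟨h, h'⟩⟩
    obtain ⟨d, hβd, hdm⟩ := exists_between (hmA' x hloc.self_of_nhds).1.2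
    refine ⟨d, hβd, ?_⟩
    filter_upwards [hloc, hc.eventually (lt_mem_nhds hdm)] with z hz hzd y hy hyd
    by_contra hlt
    exact absurd ((hmA' z hz).2 y hy (not_le.1 hlt)) (not_le.2 (hyd.trans hzd))
  · obtain ⟨d, hd⟩ := exists_gt (β x)
    exact ⟨d, hd, hloc.mono fun z hz y hy _ => not_lt.1 fun h => hz ⟨y, hy, h⟩⟩

/-- Generically, the fibres of `A` are locally trivial. Otherwise choose a definable function `β`
of points where they are not; at a generic point, `β` and the neighbouring elements of the
fibres are continuous, which makes `A` locally trivial on the graph of `β`. -/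
lemma eventually_generic_normal (hA : DP L M (fun q : (Fin k → M) × M => A q.1 q.2))
    (hfin : ∀ x, {y | A x y}.Finite) : ∀ᶠ x in generic (Fin k → M), ∀ b, Normal A x b := by
  have hT := tame_fin L M k
  have hN := dp_normal hA
  obtain ⟨β, hβ, hβN⟩ := exists_df_choice (p := fun x b => ¬ Normal A x b) hN.not
  filter_upwards [hT.cont β hβ, hT.locConst (fun x => A x (β x)) (by fun_prop),
    eventually_generic_gap_below hA hfin hβ, eventually_generic_gap_above hA hfin hβ]
    with x hc hloc ⟨c, hcβ, hgc⟩ ⟨d, hβd, hgd⟩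
  by_contra! hcon
  refine hβN x hcon ?_
  have hgap : ∀ᶠ z in 𝓝 x, ∀ y, y ∈ Ioo c d → A z y → y = β z := by
    filter_upwards [hgc, hgd] with z h1 h2 y hy hzy
    exact le_antisymm (h2 y hzy hy.2) (h1 y hzy hy.1)
  refine ⟨fun hx => ?_, fun hx => ⟨c, d, hcβ, hβd, ?_⟩⟩
  · replace hloc := hloc.resolve_right fun h => h.self_of_nhds hx
    refine ⟨⟨c, d, hcβ, hβd, ?_⟩, fun c' d' hc' hd' => ?_⟩
    · filter_upwards [hgap] with z hz y y' hy hy' h h'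
      rw [hz y hy h, hz y' hy' h']
    · filter_upwards [hloc, hc.eventually (Ioo_mem_nhds hc' hd')] with z hz hz'
      exact ⟨β z, hz', hz⟩
  · replace hloc := hloc.resolve_left fun h => hx h.self_of_nhds
    filter_upwards [hgap, hloc] with z hz hz' y hy h
    exact hz' (hz y hy h ▸ h)

/-- Where `A` is locally bounded and locally trivial, its fibres have locally constant size.
The proof counts elements up to a bound `b` and lets `b` increase. -/
lemma eventually_ncard_eq (hA : DP L M (fun q : (Fin k → M) × M => A q.1 q.2))
    (hfin : ∀ x, {y | A x y}.Finite) {x : Fin k → M} (hb : LocBounded A x)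
    (hN : ∀ b, Normal A x b) : ∀ᶠ z in 𝓝 x, {y | A z y}.ncard = {y | A x y}.ncard := by
  obtain ⟨c, d, hcd⟩ := hb
  let cnt : (Fin k → M) → M → ℕ := fun z b => {y | A z y ∧ y ≤ b}.ncard
  have hfin' : ∀ z b, {y | A z y ∧ y ≤ b}.Finite := fun z b => (hfin z).subset fun y hy => hy.1
  have hcnt : ∀ n, DP L M (fun q : (Fin k → M) × M => cnt q.1 q.2 = n) := fun n =>
    DP.ncard_eq (X := (Fin k → M) × M) (B := fun q y => A q.1 y ∧ y ≤ q.2) (by fun_prop)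
      (fun q => hfin' q.1 q.2) n
  -- The count up to `b` can fail to be locally constant when `b` lies in the fibre over `x`, as the
  -- element of a nearby fibre may then be on either side of `b`.
  let Z : M → Prop := fun b => ¬ A x b ∧ ¬ ∀ᶠ z in 𝓝 x, cnt z b = cnt x b
  have hZ : DP L M Z := by
    have h1 : ∀ b, (∀ᶠ z in 𝓝 x, cnt z b = cnt x b) ↔
        ∃ n : Fin ({y | A x y}.ncard + 1), cnt x b = n ∧ ∀ᶠ z in 𝓝 x, cnt z b = n := by
      intro b
      have hle : cnt x b ≤ {y | A x y}.ncard := ncard_le_ncard (fun y hy => hy.1) (hfin x)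
      refine ⟨fun h => ⟨⟨cnt x b, by omega⟩, rfl, h⟩, ?_⟩
      rintro ⟨n, h1, h2⟩
      rw [h1]
      exact h2
    refine DP.and (by fun_prop) (DP.not ?_)
    simp only [h1]
    refine DP.ex_fin fun n => DP.and ?_ (DP.eventually_nhds ?_ ?_)
    · exact (hcnt n).comp (f := fun b => (x, b)) (by fun_prop)
    · exact (hcnt n).comp (f := fun q : M × (Fin k → M) => (q.2, q.1)) (by fun_prop)
    · fun_prop
  have hadd : ∀ z b b', b ≤ b' → cnt z b' = cnt z b + {y | A z y ∧ y ∈ Ioc b b'}.ncard := by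
    intro z b b' hbb'
    have hun : {y | A z y ∧ y ≤ b'} = {y | A z y ∧ y ≤ b} ∪ {y | A z y ∧ y ∈ Ioc b b'} := by
      ext y
      simp only [mem_ofPred_eq, mem_union, mem_Ioc]
      constructor
      · rintro ⟨h1, h2⟩
        rcases le_or_gt y b with h | h
        · exact Or.inl ⟨h1, h⟩
        · exact Or.inr ⟨h1, h, h2⟩
      · rintro (⟨h1, h2⟩ | ⟨h1, h2, h3⟩)
        · exact ⟨h1, h2.trans hbb'⟩
        · exact ⟨h1, h3⟩
    change ncard _ = ncard _ + _
    rw [hun, ncard_union_eq ?_ (hfin' z b) ((hfin z).subset fun y hy => hy.1)]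
    rw [Set.disjoint_left]
    rintro y ⟨-, h⟩ ⟨-, h', -⟩
    exact absurd h (not_le.2 h')
  -- The count up to `b` is locally constant for every `b` outside the fibre.
  have hZempty : ∀ b, ¬ Z b := by
    by_contra! hne
    have hbd : ∀ b, Z b → c ≤ b := by
      intro b hb
      by_contra hlt
      refine hb.2 ?_
      have : ∀ᶠ z in 𝓝 x, cnt z b = 0 := by
        filter_upwards [hcd] with z hz
        refine (ncard_eq_zero (hfin' z b)).2 (eq_empty_of_forall_notMem fun y hy => ?_)
        exact absurd (hy.2.trans_lt (not_le.1 hlt)) (hz y hy.1).1.not_gt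
      filter_upwards [this] with z hz
      rw [hz, this.self_of_nhds]
    obtain ⟨g, hg⟩ := exists_isGLB hZ hne ⟨c, hbd⟩
    have hbelow : ∀ b, b < g → ¬ A x b → ∀ᶠ z in 𝓝 x, cnt z b = cnt x b := fun b hb hxb =>
      by_contra fun h => absurd (hg.1 ⟨hxb, h⟩) (not_le.2 hb)
    have hfinal : ∀ b0 b1 m, b0 < g → ¬ A x b0 → g ≤ b1 → Z b1 →
        (∀ᶠ z in 𝓝 x, {y | A z y ∧ y ∈ Ioc b0 b1}.ncard = m) → False := by
      intro b0 b1 m h0 h0' h1 h1' hm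
      refine h1'.2 ?_
      filter_upwards [hm, hbelow b0 h0 h0'] with z hz hz'
      rw [hadd z b0 b1 (h0.le.trans h1), hadd x b0 b1 (h0.le.trans h1), hz, hz', hm.self_of_nhds]
    by_cases hxg : A x g
    · obtain ⟨⟨c1, d1, hc1, hd1, huniq⟩, hex⟩ := (hN g).1 hxg
      obtain ⟨b0, hcb0, hb0g⟩ := exists_between hc1
      obtain ⟨b1, hb1, hgb1, hb1d⟩ := hg.exists_between hd1
      have hgb1' : g < b1 := lt_of_le_of_ne hgb1 fun h => hb1.1 (h ▸ hxg)
      refine hfinal b0 b1 1 hb0g (fun h => ?_) hgb1 hb1 ?_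
      · exact hb0g.ne (huniq.self_of_nhds b0 g ⟨hcb0, hb0g.trans hd1⟩ ⟨hc1, hd1⟩ h hxg)
      · filter_upwards [huniq, hex b0 b1 hb0g hgb1'] with z hz ⟨y, hy, hzy⟩
        rw [ncard_eq_one]
        refine ⟨y, ext fun y' => ⟨fun hy' => ?_, ?_⟩⟩
        · exact hz y' y ⟨hcb0.trans hy'.2.1, hy'.2.2.trans_lt hb1d⟩
            ⟨hcb0.trans hy.1, hy.2.trans hb1d⟩ hy'.1 hzy
        · rintro rfl
          exact ⟨hzy, hy.1, hy.2.le⟩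
    · obtain ⟨c1, d1, hc1, hd1, hno⟩ := (hN g).2 hxg
      obtain ⟨b0, hcb0, hb0g⟩ := exists_between hc1
      obtain ⟨b1, hb1, hgb1, hb1d⟩ := hg.exists_between hd1
      refine hfinal b0 b1 0 hb0g (hno.self_of_nhds b0 ⟨hcb0, hb0g.trans hd1⟩) hgb1 hb1 ?_
      filter_upwards [hno] with z hz
      refine (ncard_eq_zero ((hfin z).subset fun y hy => hy.1)).2
        (eq_empty_of_forall_notMem fun y hy => ?_)
      exact hz y ⟨hcb0.trans hy.2.1, hy.2.2.trans_lt hb1d⟩ hy.1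
  have hd : ∀ᶠ z in 𝓝 x, cnt z d = cnt x d := by
    have h1 := hZempty d
    have h2 : ¬ A x d := fun h => lt_irrefl d (hcd.self_of_nhds d h).2
    by_contra h
    exact h1 ⟨h2, h⟩
  have hall : ∀ᶠ z in 𝓝 x, cnt z d = {y | A z y}.ncard := by
    filter_upwards [hcd] with z hz
    exact congrArg ncard (Set.ext fun y => ⟨fun h => h.1, fun h => ⟨h, (hz y h).2.le⟩⟩)
  filter_upwards [hd, hall] with z h1 h2
  rw [← h2, ← hall.self_of_nhds, h1]

/-- Over a thin set, uniform finiteness follows from uniform finiteness in one variable less. -/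
lemma CoveredOn.of_thin {A : (Fin (k + 1) → M) → M → Prop} (hU : UniformlyFinite L M k)
    (hA : DP L M (fun q : (Fin (k + 1) → M) × M => A q.1 q.2)) (hfin : ∀ x, {y | A x y}.Finite)
    {E : Set (Fin (k + 1) → M)} (hE : Thin L E) : CoveredOn L A E := by
  obtain ⟨hEd, i, hi⟩ := hE
  have hr : DF L M (fun x : Fin (k + 1) → M => x ∘ i.succAbove) := df_reindex _
  obtain ⟨s, hs, hsE⟩ := exists_df_choice (L := L) (X := Fin k → M) (Y := Fin (k + 1) → M)
    (p := fun z x => x ∈ E ∧ x ∘ i.succAbove = z) (DP.and (by fun_prop)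
      (DP.eq (hr.comp DF.snd) (by fun_prop)))
  obtain ⟨F, h1, h2, h3⟩ := hU (fun z y => s z ∈ E ∧ A (s z) y) (by fun_prop)
    (fun z => (hfin (s z)).subset fun y hy => hy.2)
  refine ⟨(fun f => fun x => f (x ∘ i.succAbove)) '' F, h1.image _, ?_, fun x hx y hxy => ?_⟩
  · rintro _ ⟨f, hf, rfl⟩
    exact (h2 f hf).comp hr
  · obtain ⟨hsE1, hsE2⟩ := hsE (x ∘ i.succAbove) ⟨x, hx, rfl⟩
    have hsx : s (x ∘ i.succAbove) = x := by
      refine hi _ hsE1 _ hx fun j hj => ?_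
      obtain ⟨j', rfl⟩ := Fin.exists_succAbove_eq hj
      exact congrFun hsE2 j'
    obtain ⟨f, hf, hfx⟩ := h3 (x ∘ i.succAbove) (mem_univ _) y ⟨hsE1, by rwa [hsx]⟩
    exact ⟨_, mem_image_of_mem _ hf, hfx⟩

lemma uniformlyFinite_of_decomposable (hD : Decomposable L M k)
    (hprev : ∀ j, k = j + 1 → UniformlyFinite L M j) : UniformlyFinite L M k := by
  intro A hA hfin
  let G : Set (Fin k → M) := {x | LocBounded A x ∧ ∀ b, Normal A x b}
  have hGgen : ∀ᶠ x in generic (Fin k → M), x ∈ G :=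
    (eventually_generic_locBounded hA hfin).and (eventually_generic_normal hA hfin)
  have hG : DP L M (fun x => x ∈ G) := (dp_locBounded hA).and (DP.all (dp_normal hA))
  have hthin : ∀ E : Set (Fin k → M), Thin L E → CoveredOn L A E := by
    intro E hE
    cases k with
    | zero => exact hE.2.choose.elim0
    | succ k => exact CoveredOn.of_thin (hprev k rfl) hA hfin hE
  obtain ⟨𝒞, h𝒞, hC, h𝒞G⟩ := hD G hG
  obtain ⟨𝒟, h𝒟, hC', h𝒟G⟩ := hD Gᶜ hG.not
  have huniv : ⋃₀ (𝒞 ∪ 𝒟) = univ := by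
    rw [sUnion_union, h𝒞G, h𝒟G, union_compl_self]
  rw [← huniv]
  refine CoveredOn.sUnion (h𝒞.union h𝒟) ?_
  rintro C (hC𝒞 | hC𝒟)
  · refine (hC C hC𝒞).elim (fun hcell => ?_) (hthin C)
    have hCG : C ⊆ G := h𝒞G ▸ subset_sUnion_of_mem hC𝒞
    obtain ⟨x0, hx0⟩ := hcell.nonempty
    refine CoveredOn.of_ncard_le {y | A x0 y}.ncard hA hfin fun x hx => le_of_eq ?_
    refine (hcell.iff_of_locConst (DP.ncard_eq hA hfin {y | A x0 y}.ncard) ?_ hx hx0).2 rfl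
    intro z hz
    have hev := eventually_ncard_eq hA hfin (hCG hz).1 (hCG hz).2
    by_cases h : {y | A z y}.ncard = {y | A x0 y}.ncard
    · exact Or.inl (hev.mono fun w hw => hw.trans h)
    · exact Or.inr (hev.mono fun w hw hw' => h (hw.symm.trans hw'))
  · refine (hC' C hC𝒟).elim (fun hcell => ?_) (hthin C)
    obtain ⟨x, hx, hxG⟩ := exists_of_eventually_generic hGgen hcell.isOpen hcell.nonempty
    have : C ⊆ Gᶜ := h𝒟G ▸ subset_sUnion_of_mem hC𝒟
    exact absurd hxG (this hx)

end Decomposition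

section Decomposition

variable {L : Language} {M : Type*} [LinearOrder M] [TopologicalSpace M] [L.Structure M]
variable [OrderTopology M] [NoMinOrder M] [NoMaxOrder M] [DenselyOrdered M] [OM L M] [Nonempty M]

/-! ### Decomposition into open cells and thin sets -/

variable {k : ℕ}

/-- The open cells of a decomposition can be chosen so that finitely many given definable
functions are continuous on them. -/
lemma Decomposable.finUnion_continuousOn (hD : Decomposable L M k) {X : Set (Fin k → M)}
    (hX : DP L M (fun x => x ∈ X)) {F : Set ((Fin k → M) → M)} (hF : F.Finite)
    (hFd : ∀ f ∈ F, DF L M f) :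
    FinUnion (fun C => (IsOpenCell L C ∧ ∀ f ∈ F, ContinuousOn f C) ∨ Thin L C) X := by
  let Z : Set (Fin k → M) := {x | ¬ ∀ f ∈ F, ContinuousAt f x}
  have hZ : DP L M (fun x => x ∈ Z) := by
    have := hF.to_subtype
    have h : DP L M (fun x => ∀ f : F, ContinuousAt (f : (Fin k → M) → M) x) := by
      refine DP.all_fin fun f => ?_
      have := hFd f f.2
      fun_prop
    simpa only [Z, mem_ofPred_eq, Subtype.forall] using h.not
  have hgen : ∀ᶠ x in generic (Fin k → M), x ∉ Z := by
    simp only [Z, mem_ofPred_eq, not_not]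
    exact (eventually_all_finite hF).2 fun f hf => (tame_fin L M k).cont f (hFd f hf)
  rw [← inter_union_compl X Z]
  refine FinUnion.union ((hD (X ∩ Z) (hX.and hZ)).bind fun C hC hCX => .of_mem ?_)
    ((hD (X ∩ Zᶜ) (hX.and hZ.not)).bind fun C hC hCX => .of_mem ?_)
  · refine hC.elim (fun hcell => ?_) Or.inr
    obtain ⟨x, hx, hxZ⟩ := exists_of_eventually_generic hgen hcell.isOpen hcell.nonempty
    exact absurd (hCX hx).2 hxZ
  · refine hC.imp_left fun hcell => ⟨hcell, fun f hf x hx => ?_⟩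
    exact (not_not.1 (hCX hx).2 f hf).continuousWithinAt

/-- The relation `f x < y`, where `none` stands for the function `-∞`. -/
def AboveLower (o : Option ((Fin k → M) → M)) (x : Fin k → M) (y : M) : Prop :=
  ∀ f ∈ o, f x < y

/-- The relation `y < f x`, where `none` stands for the function `+∞`. -/
def BelowUpper (o : Option ((Fin k → M) → M)) (x : Fin k → M) (y : M) : Prop :=
  ∀ f ∈ o, y < f x

lemma dp_aboveLower {o : Option ((Fin k → M) → M)} (ho : ∀ f ∈ o, DF L M f) :
    DP L M (fun q : (Fin k → M) × M => AboveLower o q.1 q.2) := by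
  cases o with
  | none =>
    simp only [AboveLower, Option.not_mem_none, false_imp_iff, implies_true]
    exact DP.const True
  | some f =>
    have := ho f rfl
    simp only [AboveLower, Option.mem_some_iff, forall_eq']
    fun_prop

lemma dp_belowUpper {o : Option ((Fin k → M) → M)} (ho : ∀ f ∈ o, DF L M f) :
    DP L M (fun q : (Fin k → M) × M => BelowUpper o q.1 q.2) := by
  cases o with
  | none =>
    simp only [BelowUpper, Option.not_mem_none, false_imp_iff, implies_true]
    exact DP.const True
  | some f =>
    have := ho f rfl
    simp only [BelowUpper, Option.mem_some_iff, forall_eq']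
    fun_prop

lemma isOpenCell_between {C : Set (Fin k → M)} (hC : IsOpenCell L C)
    {o o' : Option ((Fin k → M) → M)} (ho : ∀ f ∈ o, DF L M f) (ho' : ∀ f ∈ o', DF L M f)
    (hc : ∀ f ∈ o, ContinuousOn f C) (hc' : ∀ f ∈ o', ContinuousOn f C)
    (hne : ∀ x ∈ C, ∃ y, AboveLower o x y ∧ BelowUpper o' x y) :
    IsOpenCell L {x : Fin (k + 1) → M | x ∘ Fin.castSucc ∈ C ∧
      AboveLower o (x ∘ Fin.castSucc) (x (Fin.last k)) ∧
      BelowUpper o' (x ∘ Fin.castSucc) (x (Fin.last k))} := by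
  have hlow : ∃ F, IsBound L C F ∧ ∀ (x : Fin k → M) (y : M),
      F x < ((y : WithTop M) : WithBot (WithTop M)) ↔ AboveLower o x y := by
    cases o with
    | none =>
      exact ⟨fun _ => ⊥, Or.inr (Or.inl fun _ _ => rfl), fun x y => by simp [AboveLower]⟩
    | some f =>
      exact ⟨_, IsBound.some hC.dp (hc f rfl) (ho f rfl), fun x y => by simp [AboveLower]⟩
  have hup : ∃ G, IsBound L C G ∧ ∀ (x : Fin k → M) (y : M),
      ((y : WithTop M) : WithBot (WithTop M)) < G x ↔ BelowUpper o' x y := by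
    cases o' with
    | none =>
      exact ⟨fun _ => ⊤, Or.inr (Or.inr fun _ _ => rfl), fun x y => by
        simpa [BelowUpper] using WithBot.coe_lt_coe.2 (WithTop.coe_lt_top y)⟩
    | some f =>
      exact ⟨_, IsBound.some hC.dp (hc' f rfl) (ho' f rfl), fun x y => by simp [BelowUpper]⟩
  obtain ⟨F, hF, hFo⟩ := hlow
  obtain ⟨G, hG, hGo⟩ := hup
  refine isOpenCell_succ_iff.2 ⟨C, F, G, hC, hF, hG, fun x hx => ?_, ?_⟩
  · obtain ⟨y, hy, hy'⟩ := hne x hx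
    exact ((hFo x y).2 hy).trans ((hGo x y).2 hy')
  · ext x
    simp only [mem_ofPred_eq, hFo, hGo]

/-- Finitely many definable functions that hit all the points where the fibres of `X` are not
locally constant cut `X` into graphs and bands between two of the functions. -/
lemma decomposable_succ (hD : Decomposable L M k) (hU : UniformlyFinite L M k) :
    Decomposable L M (k + 1) := by
  intro X hX
  let P : (Fin k → M) → M → Prop := fun x y => Fin.snoc (α := fun _ => M) x y ∈ X
  have hP : DP L M (fun q : (Fin k → M) × M => P q.1 q.2) := hX.comp (df_snoc k)
  let A : (Fin k → M) → M → Prop := fun x y =>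
    ¬ ((∀ᶠ y' in 𝓝 y, P x y') ∨ ∀ᶠ y' in 𝓝 y, ¬ P x y')
  have hA : DP L M (fun q : (Fin k → M) × M => A q.1 q.2) := by
    refine DP.not (DP.or (DP.eventually_nhds ?_ ?_) (DP.eventually_nhds ?_ ?_)) <;> fun_prop
  have hfin : ∀ x, {y | A x y}.Finite := by
    intro x
    by_contra hinf
    obtain ⟨a, b, hab, h⟩ := exists_Ioo_subset_of_infinite (L := L) (p := A x) (by fun_prop) hinf
    obtain ⟨a', b', hab', hs, h'⟩ := exists_subinterval (L := L) (p := P x) (by fun_prop) hab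
    obtain ⟨y, hy⟩ := exists_between hab'
    exact h y (hs hy) (h'.imp (fun h' => mem_of_superset (Ioo_mem_nhds hy.1 hy.2) h')
      fun h' => mem_of_superset (Ioo_mem_nhds hy.1 hy.2) h')
  obtain ⟨F, hF, hFd, hFA⟩ := hU A hA hfin
  let O : Set (Option ((Fin k → M) → M)) := insert none (some '' F)
  have hO : O.Finite := (hF.image _).insert _
  have hOF : ∀ o ∈ O, ∀ f ∈ o, f ∈ F := by
    rintro o (rfl | ⟨f, hf, rfl⟩) g hg
    · exact absurd hg (by simp)
    · obtain rfl : f = g := by simpa using hg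
      exact hf
  -- The graphs, and the bands over the sets `S` of points where the band is contained in `X`.
  let graph : ((Fin k → M) → M) → Set (Fin (k + 1) → M) := fun f =>
    {x | x ∈ X ∧ f (x ∘ Fin.castSucc) = x (Fin.last k)}
  let S : Option ((Fin k → M) → M) × Option ((Fin k → M) → M) → Set (Fin k → M) := fun o =>
    {x | (∃ y, AboveLower o.1 x y ∧ BelowUpper o.2 x y) ∧
      ∀ y, AboveLower o.1 x y → BelowUpper o.2 x y → P x y}
  let band : Option ((Fin k → M) → M) × Option ((Fin k → M) → M) → (Fin k → M) →
      Set (Fin (k + 1) → M) := fun o x =>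
    {z | z ∘ Fin.castSucc = x ∧ AboveLower o.1 x (z (Fin.last k)) ∧
      BelowUpper o.2 x (z (Fin.last k))}
  have hband : ∀ (o : Option ((Fin k → M) → M) × Option ((Fin k → M) → M)) (C : Set (Fin k → M)),
      ⋃ x ∈ C, band o x = {z : Fin (k + 1) → M | z ∘ Fin.castSucc ∈ C ∧
      AboveLower o.1 (z ∘ Fin.castSucc) (z (Fin.last k)) ∧
      BelowUpper o.2 (z ∘ Fin.castSucc) (z (Fin.last k))} := by
    intro o C
    ext z
    simp only [band, mem_iUnion, mem_ofPred_eq]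
    constructor
    · rintro ⟨x, hx, rfl, h⟩
      exact ⟨hx, h⟩
    · rintro ⟨hx, h⟩
      exact ⟨_, hx, rfl, h⟩
  have hinit : DF L M (fun x : Fin (k + 1) → M => x ∘ Fin.castSucc) := df_reindex _
  have hXeq : X = (⋃ f ∈ F, graph f) ∪ ⋃ o ∈ O ×ˢ O, ⋃ x ∈ S o, band o x := by
    ext z
    simp only [hband, mem_union, mem_iUnion, exists_prop]
    constructor
    · intro hz
      set x := z ∘ Fin.castSucc with hx
      set y := z (Fin.last k) with hy
      have hz' : P x y := by
        simpa only [P, hx, hy, snoc_castSucc_last] using hz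
      by_cases hxy : A x y
      · left
        obtain ⟨f, hf, hfx⟩ := hFA x (mem_univ _) y hxy
        exact ⟨f, hf, hz, hfx⟩
      · right
        have hlow : ∃ o ∈ O, AboveLower o x y ∧ ∀ f ∈ F, f x < y → ∃ g ∈ o, f x ≤ g x := by
          by_cases hne : ∃ f, f ∈ F ∧ f x < y
          · obtain ⟨g, hg, hmax⟩ := Set.exists_max_image {f | f ∈ F ∧ f x < y} (fun f => f x)
              (hF.subset fun f hf => hf.1) hne
            refine ⟨some g, mem_insert_of_mem _ ⟨g, hg.1, rfl⟩, ?_, fun f hf hfy =>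
              ⟨g, rfl, hmax f ⟨hf, hfy⟩⟩⟩
            simpa [AboveLower] using hg.2
          · exact ⟨none, mem_insert _ _, by simp [AboveLower],
              fun f hf hfy => absurd ⟨f, hf, hfy⟩ hne⟩
        have hup : ∃ o ∈ O, BelowUpper o x y ∧ ∀ f ∈ F, y < f x → ∃ g ∈ o, g x ≤ f x := by
          by_cases hne : ∃ f, f ∈ F ∧ y < f x
          · obtain ⟨g, hg, hmin⟩ := Set.exists_min_image {f | f ∈ F ∧ y < f x} (fun f => f x)
              (hF.subset fun f hf => hf.1) hne
            refine ⟨some g, mem_insert_of_mem _ ⟨g, hg.1, rfl⟩, ?_, fun f hf hfy =>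
              ⟨g, rfl, hmin f ⟨hf, hfy⟩⟩⟩
            simpa [BelowUpper] using hg.2
          · exact ⟨none, mem_insert _ _, by simp [BelowUpper],
              fun f hf hfy => absurd ⟨f, hf, hfy⟩ hne⟩
        obtain ⟨o, hoO, ho, hlow⟩ := hlow
        obtain ⟨o', hoO', ho', hup⟩ := hup
        refine ⟨(o, o'), ⟨hoO, hoO'⟩, ⟨⟨y, ho, ho'⟩, fun w hw hw' => ?_⟩, ho, ho'⟩
        -- No point of the band over `x` is a point of `A`, so `P x` is constant there.
        refine (iff_of_locConst_ordConnected (L := L) (p := P x) (by fun_prop)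
          (I := {w | AboveLower o x w ∧ BelowUpper o' x w}) ⟨?_⟩ ?_ ⟨ho, ho'⟩ ⟨hw, hw'⟩).1 hz'
        · intro u hu v hv w hw
          exact ⟨fun f hf => (hu.1 f hf).trans_le hw.1, fun f hf => hw.2.trans_lt (hv.2 f hf)⟩
        · intro w hw
          by_contra hAw
          obtain ⟨f, hf, rfl⟩ := hFA x (mem_univ _) w hAw
          rcases lt_trichotomy (f x) y with h | h | h
          · obtain ⟨g, hg, hfg⟩ := hlow f hf h
            exact absurd (hw.1 g hg) (not_lt.2 hfg)
          · exact hxy (h ▸ hAw)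
          · obtain ⟨g, hg, hfg⟩ := hup f hf h
            exact absurd (hw.2 g hg) (not_lt.2 hfg)
    · rintro (⟨f, -, hz, -⟩ | ⟨o, -, hS, h, h'⟩)
      · exact hz
      · simpa only [P, snoc_castSucc_last] using hS.2 _ h h'
  rw [hXeq]
  refine FinUnion.union (FinUnion.biUnion hF fun f hf => .of_mem (Or.inr ⟨?_, Fin.last k, ?_⟩))
    (FinUnion.biUnion (hO.prod hO) fun o ho => ?_)
  · have := hFd f hf
    change DP L M (fun x => x ∈ X ∧ f (x ∘ Fin.castSucc) = x (Fin.last k))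
    fun_prop
  · intro x hx y hy hxy
    have hxy' : x ∘ Fin.castSucc = y ∘ Fin.castSucc :=
      funext fun j => hxy _ (Fin.castSucc_lt_last j).ne
    rw [← snoc_castSucc_last x, ← snoc_castSucc_last y, ← hx.2, ← hy.2, hxy']
  · have ho1 : ∀ f ∈ o.1, DF L M f := fun f hf => hFd f (hOF _ ho.1 f hf)
    have ho2 : ∀ f ∈ o.2, DF L M f := fun f hf => hFd f (hOF _ ho.2 f hf)
    have hab := dp_aboveLower ho1
    have hbe := dp_belowUpper ho2
    have hS : DP L M (fun x => x ∈ S o) := by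
      refine DP.and ?_ (DP.all (DP.imp ?_ (DP.imp ?_ ?_))) <;> fun_prop
    refine (hD.finUnion_continuousOn hS hF hFd).map (band o) fun C hC hCS => .of_mem ?_
    rw [hband]
    rcases hC with ⟨hcell, hcont⟩ | ⟨hCd, i, hi⟩
    · exact Or.inl (isOpenCell_between hcell ho1 ho2 (fun f hf => hcont f (hOF _ ho.1 f hf))
        (fun f hf => hcont f (hOF _ ho.2 f hf)) fun x hx => (hCS hx).1)
    · refine Or.inr ⟨?_, i.castSucc, fun x hx y hy hxy => ?_⟩
      · simp only [mem_ofPred_eq]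
        refine DP.and (hCd.comp hinit) (DP.and (hab.comp (f := fun x : Fin (k + 1) → M =>
          (x ∘ Fin.castSucc, x (Fin.last k))) ?_) (hbe.comp (f := fun x : Fin (k + 1) → M =>
          (x ∘ Fin.castSucc, x (Fin.last k))) ?_)) <;> fun_prop
      · have h1 : x ∘ Fin.castSucc = y ∘ Fin.castSucc := hi _ hx.1 _ hy.1 fun j hj =>
          hxy _ fun h => hj (Fin.castSucc_injective _ h)
        have h2 : x (Fin.last k) = y (Fin.last k) := hxy _ (Fin.castSucc_lt_last i).ne'
        rw [← snoc_castSucc_last x, ← snoc_castSucc_last y, h1, h2]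

variable (L M) in
lemma decomposable_zero : Decomposable L M 0 := by
  intro X _
  rcases X.eq_empty_or_nonempty with rfl | ⟨x, hx⟩
  · exact ⟨∅, finite_empty, by simp, sUnion_empty⟩
  · refine .of_mem (Or.inl ?_)
    change X = univ
    exact eq_univ_of_forall fun y => Subsingleton.elim x y ▸ hx

variable (L M) in
lemma decomposable_and_uniformlyFinite (k : ℕ) :
    Decomposable L M k ∧ UniformlyFinite L M k := by
  induction k with
  | zero =>
    exact ⟨decomposable_zero L M, uniformlyFinite_of_decomposable (decomposable_zero L M)
      fun j hj => absurd hj (by omega)⟩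
  | succ k ih =>
    have hD := decomposable_succ ih.1 ih.2
    refine ⟨hD, uniformlyFinite_of_decomposable hD fun j hj => ?_⟩
    obtain rfl : k = j := by omega
    exact ih.2

variable (L M) in
/-- Every definable subset of `M ^ k` is a finite union of open cells and thin sets. -/
theorem decomposable (k : ℕ) : Decomposable L M k :=
  (decomposable_and_uniformlyFinite L M k).1

/-! ### Covering open sets by open cells -/

/-- A box whose sides depend continuously on a point of an open cell, fibred over that cell, is an
open cell. -/
lemma isOpenCell_tube {C : Set (Fin k → M)} (hC : IsOpenCell L C) (m : ℕ)
    (l r : Fin m → (Fin k → M) → M) (hl : ∀ j, DF L M (l j)) (hr : ∀ j, DF L M (r j))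
    (hlc : ∀ j, ContinuousOn (l j) C) (hrc : ∀ j, ContinuousOn (r j) C)
    (hlr : ∀ x ∈ C, ∀ j, l j x < r j x) :
    IsOpenCell L {x : Fin (k + m) → M | x ∘ Fin.castAdd m ∈ C ∧
      ∀ j, l j (x ∘ Fin.castAdd m) < x (Fin.natAdd k j) ∧
        x (Fin.natAdd k j) < r j (x ∘ Fin.castAdd m)} := by
  induction m with
  | zero =>
    have : {x : Fin (k + 0) → M | x ∘ Fin.castAdd 0 ∈ C ∧
      ∀ j, l j (x ∘ Fin.castAdd 0) < x (Fin.natAdd k j) ∧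
        x (Fin.natAdd k j) < r j (x ∘ Fin.castAdd 0)} = C := by
      ext x
      simp only [IsEmpty.forall_iff, and_true, mem_ofPred_eq]
      rfl
    rw [this]
    exact hC
  | succ m ih =>
    have hX := ih (fun j => l j.castSucc) (fun j => r j.castSucc) (fun j => hl _) (fun j => hr _)
      (fun j => hlc _) (fun j => hrc _) (fun x hx j => hlr x hx _)
    have hre : DF L M (fun x : Fin (k + m) → M => x ∘ Fin.castAdd m) := df_reindex _
    have hcomp : ∀ f : (Fin k → M) → M, ContinuousOn f C →
        ContinuousOn (fun x : Fin (k + m) → M => f (x ∘ Fin.castAdd m))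
          {x : Fin (k + m) → M | x ∘ Fin.castAdd m ∈ C ∧
            ∀ j : Fin m, l j.castSucc (x ∘ Fin.castAdd m) < x (Fin.natAdd k j) ∧
              x (Fin.natAdd k j) < r j.castSucc (x ∘ Fin.castAdd m)} := fun f hf =>
      hf.comp (Continuous.continuousOn (by fun_prop)) fun x hx => hx.1
    refine isOpenCell_succ_iff.2 ⟨_, _, _, hX,
      IsBound.some hX.dp (hcomp _ (hlc (Fin.last m))) ((hl _).comp hre),
      IsBound.some hX.dp (hcomp _ (hrc (Fin.last m))) ((hr _).comp hre), fun x hx => ?_, ?_⟩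
    · simpa using hlr _ hx.1 (Fin.last m)
    · ext x
      constructor
      · rintro ⟨h1, h2⟩
        exact ⟨⟨h1, fun j => h2 j.castSucc⟩,
          WithBot.coe_lt_coe.2 (WithTop.coe_lt_coe.2 (h2 (Fin.last m)).1),
          WithBot.coe_lt_coe.2 (WithTop.coe_lt_coe.2 (h2 (Fin.last m)).2)⟩
      · rintro ⟨⟨h1, h2⟩, h3, h4⟩
        exact ⟨h1, Fin.lastCases ⟨WithTop.coe_lt_coe.1 (WithBot.coe_lt_coe.1 h3),
          WithTop.coe_lt_coe.1 (WithBot.coe_lt_coe.1 h4)⟩ h2⟩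

/-- An injection `Fin k → Fin (k + m)` extends to a permutation. -/
lemma exists_perm_extending {k m : ℕ} {τ : Fin k → Fin (k + m)} (hτ : Function.Injective τ) :
    ∃ σ : Equiv.Perm (Fin (k + m)), ∀ j, σ (Fin.castAdd m j) = τ j := by
  classical
  let e : {x // x ∈ range (Fin.castAdd (n := k) m)} ≃ {x // x ∈ range τ} :=
    (Equiv.ofInjective _ (Fin.castAdd_injective k m)).symm.trans (Equiv.ofInjective τ hτ)
  refine ⟨e.extendSubtype, fun j => ?_⟩
  rw [e.extendSubtype_apply_of_mem _ (mem_range_self j)]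
  have h : (Equiv.ofInjective _ (Fin.castAdd_injective k m)).symm
      ⟨Fin.castAdd m j, mem_range_self j⟩ = j := Equiv.ofInjective_symm_apply _ j
  rw [Equiv.trans_apply, h, Equiv.ofInjective_apply]

variable (L) in
/-- An open cell up to a permutation of the coordinates. -/
def IsPermutedCell {n : ℕ} (V : Set (Fin n → M)) : Prop :=
  ∃ (σ : Equiv.Perm (Fin n)) (C : Set (Fin n → M)), IsOpenCell L C ∧ V = {x | x ∘ σ ∈ C}

/-- Let `ψ` be a definable map from `D ⊆ M ^ k` to an open set `U`, whose value at `x` has the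
coordinates of `x` at the places `τ`. The image of `D` is covered by finitely many permuted open
cells in `U`. Over the open cells of a decomposition of `D`, tubes around the image do this, while
a thin set is parametrized by its projection to `M ^ (k - 1)`. -/
lemma exists_cover_image {n : ℕ} {U : Set (Fin n → M)} (hU : IsOpen U)
    (hUd : DP L M (fun x => x ∈ U)) (k : ℕ) {D : Set (Fin k → M)} (hD : DP L M (fun x => x ∈ D))
    {ψ : (Fin k → M) → (Fin n → M)} (hψ : DF L M ψ) {τ : Fin k → Fin n}
    (hψτ : ∀ x ∈ D, ψ x ∘ τ = x) (hτ : Function.Injective τ) (hψU : ∀ x ∈ D, ψ x ∈ U) :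
    ∃ 𝒱 : Set (Set (Fin n → M)), 𝒱.Finite ∧ (∀ V ∈ 𝒱, IsPermutedCell L V ∧ V ⊆ U) ∧
      ψ '' D ⊆ ⋃₀ 𝒱 := by
  induction k using Nat.strong_induction_on with
  | _ k ih =>
  have hbox : DP L M (fun q : (Fin k → M) × ((Fin n → M) × (Fin n → M)) =>
      (∀ i, q.2.1 i < ψ q.1 i ∧ ψ q.1 i < q.2.2 i) ∧
        ∀ z : Fin n → M, (∀ i, q.2.1 i < z i ∧ z i < q.2.2 i) → z ∈ U) := by
    refine DP.and (DP.all_fin fun i => ?_) (DP.all (DP.imp (DP.all_fin fun i => ?_) ?_)) <;>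
      fun_prop
  obtain ⟨f, hf, hfU⟩ := exists_df_choice (p := fun x (q : (Fin n → M) × (Fin n → M)) =>
    (∀ i, q.1 i < ψ x i ∧ ψ x i < q.2 i) ∧
      ∀ z : Fin n → M, (∀ i, q.1 i < z i ∧ z i < q.2 i) → z ∈ U) hbox
  replace hfU := fun x hx => hfU x (by
    obtain ⟨l, r, h⟩ := (eventually_nhds_iff_box (M := M)).1 (hU.mem_nhds (hψU x hx))
    exact ⟨(l, r), h⟩)
  let F : Set ((Fin k → M) → M) :=
    range (fun (i : Fin n) x => (f x).1 i) ∪ range (fun (i : Fin n) x => (f x).2 i)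
  have hFd : ∀ g ∈ F, DF L M g := by
    rintro g (⟨i, rfl⟩ | ⟨i, rfl⟩)
    · exact (DF.apply i).comp (f := fun v : Fin n → M => v i) (DF.fst.comp hf)
    · exact (DF.apply i).comp (f := fun v : Fin n → M => v i) (DF.snd.comp hf)
  obtain ⟨𝒞, h𝒞, hC, rfl⟩ := (decomposable L M k).finUnion_continuousOn hD
    ((finite_range _).union (finite_range _)) hFd
  have key : ∀ C ∈ 𝒞, ∃ 𝒱 : Set (Set (Fin n → M)), 𝒱.Finite ∧
      (∀ V ∈ 𝒱, IsPermutedCell L V ∧ V ⊆ U) ∧ ψ '' C ⊆ ⋃₀ 𝒱 := by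
    intro C hC𝒞
    have hCD : C ⊆ ⋃₀ 𝒞 := subset_sUnion_of_mem hC𝒞
    rcases hC C hC𝒞 with ⟨hcell, hcont⟩ | ⟨hCd, i, hi⟩
    · obtain ⟨m, rfl⟩ := Nat.exists_eq_add_of_le
        (show k ≤ n by simpa using Fintype.card_le_of_injective τ hτ)
      obtain ⟨σ, hσ⟩ := exists_perm_extending hτ
      have htube := isOpenCell_tube hcell m (fun j x => (f x).1 (σ (Fin.natAdd k j)))
        (fun j x => (f x).2 (σ (Fin.natAdd k j))) (fun j => hFd _ (Or.inl (mem_range_self _)))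
        (fun j => hFd _ (Or.inr (mem_range_self _)))
        (fun j => hcont _ (Or.inl (mem_range_self _)))
        (fun j => hcont _ (Or.inr (mem_range_self _)))
        (fun x hx j => ((hfU x (hCD hx)).1 _).1.trans ((hfU x (hCD hx)).1 _).2)
      have hcomp : ∀ x : Fin (k + m) → M, (x ∘ σ) ∘ Fin.castAdd m = x ∘ τ := fun x =>
        funext fun j => congrArg x (hσ j)
      refine ⟨{{x | x ∘ σ ∈ {y : Fin (k + m) → M | y ∘ Fin.castAdd m ∈ C ∧
          ∀ j, (f (y ∘ Fin.castAdd m)).1 (σ (Fin.natAdd k j)) < y (Fin.natAdd k j) ∧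
            y (Fin.natAdd k j) < (f (y ∘ Fin.castAdd m)).2 (σ (Fin.natAdd k j))}}},
        finite_singleton _, ?_, ?_⟩
      · rintro V rfl
        refine ⟨⟨σ, _, htube, rfl⟩, ?_⟩
        rintro x ⟨hx, hlr⟩
        simp only [hcomp] at hx hlr
        refine (hfU _ (hCD hx)).2 x fun i => ?_
        obtain ⟨i, rfl⟩ := σ.surjective i
        refine Fin.addCases (fun j => ?_) (fun j => hlr j) i
        -- At the places `τ`, the coordinates of `x` and of `ψ (x ∘ τ)` agree.
        have h := congrFun (hψτ _ (hCD hx)) j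
        have h' := (hfU _ (hCD hx)).1 (τ j)
        simp only [Function.comp_apply] at h
        rw [h] at h'
        rw [hσ]
        exact h'
      · rintro _ ⟨x, hx, rfl⟩
        refine ⟨_, rfl, ?_⟩
        simp only [mem_ofPred_eq, hcomp, hψτ x (hCD hx)]
        exact ⟨hx, fun j => (hfU x (hCD hx)).1 _⟩
    · cases k with
      | zero => exact i.elim0
      | succ k =>
        have hr : DF L M (fun x : Fin (k + 1) → M => x ∘ i.succAbove) := df_reindex _
        obtain ⟨s, hs, hsC⟩ := exists_df_choice (L := L) (X := Fin k → M) (Y := Fin (k + 1) → M)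
          (p := fun z x => x ∈ C ∧ x ∘ i.succAbove = z) (DP.and (by fun_prop)
            (DP.eq (hr.comp DF.snd) (by fun_prop)))
        have hproj : DP L M (fun z => z ∈ {z : Fin k → M | ∃ x, x ∈ C ∧ x ∘ i.succAbove = z}) :=
          DP.ex (DP.and (by fun_prop) (DP.eq (hr.comp DF.snd) (by fun_prop)))
        obtain ⟨𝒱, h1, h2, h3⟩ := ih k (Nat.lt_succ_self k) hproj (ψ := fun z => ψ (s z))
          (by fun_prop) (τ := τ ∘ i.succAbove)
          (fun z hz => by
            obtain ⟨hz1, hz2⟩ := hsC z hz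
            rw [← Function.comp_assoc, hψτ _ (hCD hz1), hz2])
          (hτ.comp Fin.succAbove_right_injective) (fun z hz => hψU _ (hCD (hsC z hz).1))
        refine ⟨𝒱, h1, h2, ?_⟩
        rintro _ ⟨x, hx, rfl⟩
        obtain ⟨hz1, hz2⟩ := hsC (x ∘ i.succAbove) ⟨x, hx, rfl⟩
        have hsx : s (x ∘ i.succAbove) = x := by
          refine hi _ hz1 _ hx fun j hj => ?_
          obtain ⟨j', rfl⟩ := Fin.exists_succAbove_eq hj
          exact congrFun hz2 j'
        exact h3 ⟨x ∘ i.succAbove, ⟨x, hx, rfl⟩, by simp only [hsx]⟩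
  choose! 𝒱 h1 h2 h3 using key
  refine ⟨⋃ C ∈ 𝒞, 𝒱 C, h𝒞.biUnion h1, ?_, ?_⟩
  · simp only [mem_iUnion]
    rintro V ⟨C, hC, hV⟩
    exact h2 C hC V hV
  · rintro _ ⟨x, ⟨C, hC, hx⟩, rfl⟩
    obtain ⟨V, hV, hxV⟩ := h3 C hC ⟨x, hx, rfl⟩
    exact ⟨V, mem_biUnion hC hV, hxV⟩

/-- An open definable set is a finite union of permuted open cells. -/
theorem exists_finite_permutedCells {n : ℕ} {U : Set (Fin n → M)} (hU : IsOpen U)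
    (hUd : DP L M (fun x => x ∈ U)) :
    ∃ 𝒱 : Set (Set (Fin n → M)), 𝒱.Finite ∧ (∀ V ∈ 𝒱, IsPermutedCell L V) ∧ U = ⋃₀ 𝒱 := by
  obtain ⟨𝒱, h1, h2, h3⟩ := exists_cover_image hU hUd n hUd (ψ := fun x => x) (by fun_prop)
    (τ := fun j => j) (fun _ _ => rfl) (fun _ _ h => h) fun _ hx => hx
  refine ⟨𝒱, h1, fun V hV => (h2 V hV).1, Subset.antisymm (by simpa using h3) ?_⟩
  exact sUnion_subset fun V hV => (h2 V hV).2

lemma isDefHomeo_comp_perm {n : ℕ} {C : Set (Fin n → M)} (hC : IsOpenCell L C)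
    (σ : Equiv.Perm (Fin n)) : IsDefHomeo L (fun x => x ∘ σ) {x : Fin n → M | x ∘ σ ∈ C} C := by
  have hcont : ∀ τ : Equiv.Perm (Fin n), Continuous fun x : Fin n → M => x ∘ τ := fun τ => by
    fun_prop
  refine ⟨defMap_of_df (hC.dp.comp (df_reindex _)) (df_reindex _), ?_⟩
  have hmem : ∀ y : C, y.1 ∘ σ.symm ∈ {x : Fin n → M | x ∘ σ ∈ C} := fun y => by
    simp [Function.comp_assoc]
  refine ⟨{ toFun := fun x => ⟨x.1 ∘ σ, x.2⟩
            invFun := fun y => ⟨y.1 ∘ σ.symm, hmem y⟩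
            left_inv := fun x => by simp [Function.comp_assoc]
            right_inv := fun x => by simp [Function.comp_assoc]
            continuous_toFun := ((hcont σ).comp continuous_subtype_val).subtype_mk _
            continuous_invFun :=
              ((hcont σ.symm).comp continuous_subtype_val).subtype_mk hmem }, fun x => rfl⟩

end Decomposition

/-- In an ordered structure the order is definable, so the standing assumptions hold. -/
lemma om_of_isOMinimal {L : Language} {M : Type*} [LinearOrder M] [TopologicalSpace M]
    [L.IsOrdered] [L.Structure M] [L.OrderedStructure M] (hM : IsOMinimal L M)
    (hchoice : HasDefinableChoice L M) : OM L M where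
  omin := hM
  choice := hchoice
  lt := by
    have h : (∅ : Set M).Definable L {v : Unit ⊕ Unit → M | v (Sum.inl ()) < v (Sum.inr ())} := by
      rw [empty_definable_iff]
      refine ⟨Language.Term.lt (n := 0) (Language.Term.var (Sum.inl (Sum.inl ())))
        (Language.Term.var (Sum.inl (Sum.inr ()))), ?_⟩
      ext v
      simp [Language.Formula.Realize, Language.Term.realize_lt]
    exact h.mono (empty_subset _)

end OMin

theorem mainTheorem7 (L : FirstOrder.Language) (M : Type*) [Nonempty M] [LinearOrder M]
    [DenselyOrdered M] [NoMinOrder M] [NoMaxOrder M] [TopologicalSpace M] [OrderTopology M]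
    [L.IsOrdered] [L.Structure M] [L.OrderedStructure M]
    (hM : OMin.IsOMinimal L M) (hchoice : OMin.HasDefinableChoice L M)
    (n : ℕ) (U : Set (Fin n → M)) (hU : IsOpen U) (hUdef : OMin.Def L U) :
    ∃ (k : ℕ) (V : Fin k → Set (Fin n → M)), U = ⋃ j, V j ∧
      ∀ j, IsOpen (V j) ∧ OMin.Def L (V j) ∧
        ∃ (σ : Equiv.Perm (Fin n)) (C : Set (Fin n → M)), OMin.IsOpenCell L C ∧
          OMin.IsDefHomeo L (fun x => x ∘ σ) (V j) C := by
  have := OMin.om_of_isOMinimal hM hchoice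
  obtain ⟨𝒱, h1, h2, h3⟩ := OMin.exists_finite_permutedCells (L := L) hU hUdef
  have := h1.to_subtype
  obtain ⟨k, ⟨e⟩⟩ := Finite.exists_equiv_fin 𝒱
  refine ⟨k, fun j => (e.symm j).1, ?_, fun j => ?_⟩
  · rw [h3, Set.sUnion_eq_iUnion, ← e.symm.surjective.iUnion_comp]
  · obtain ⟨σ, C, hC, hV⟩ := h2 _ (e.symm j).2
    beta_reduce
    rw [hV]
    exact ⟨hC.isOpen.preimage (by fun_prop), hC.dp.comp (OMin.df_reindex _), σ, C, hC,
      OMin.isDefHomeo_comp_perm hC σ⟩
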